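/- Let $k$ be a field and let $0\to\mathfrak n\xrightarrow{i}\mathfrak g\xrightarrow{\pi}\mathfrak h\to 0$ be a split extension of Lie algebras over $k$ (of arbitrary dimension), with a Lie algebra homomorphism $\sigma:\mathfrak h\to\mathfrak g$ such that $\pi\sigma=\mathrm{id}$. For $\alpha\in\mathfrak h$ and $s\in\mathfrak n$ let $\alpha(s)\in\mathfrak n$ be the element with $i(\alpha(s))=[\sigma(\alpha),i(s)]$. Let $M$ be a $\mathfrak g$-module. **Compatible actions.** Let $\varepsilon:F\to k$ be a free $U(\mathfrak n)$-resolution of the trivial module $k$. One says that $\mathfrak h$ acts compatibly on $F$ if there is a Lie algebra homomorphism $\alpha\mapsto\underline\alpha$ from $\mathfrak h$ to the $k$-linear chain maps $F\to F$ extending the zero map on $k$ (with the commutator bracket) such that $\alpha(s)f=\underline\alpha(sf)-s\,\underline\alpha(f)$ for all $\alpha\in\mathfrak h$, $s\in\mathfrak n$, $f\in F_*$. **The Hochschild–Serre spectral sequence.** Let $P\to k$ be any free $U(\mathfrak h)$-resolution and $Q\to k$ any free $U(\mathfrak g)$-resolution. The algebra $\mathfrak g$ acts on $\mathrm{Hom}_k(Q_b,M)$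 by $(xf)(m)=x f(m)-f(xm)$, and this induces an action of $\mathfrak h=\mathfrak g/\mathfrak n$ on $\mathrm{Hom}_{\mathfrak n}(Q_b,M)$. Consider the double complex $C^{a,b}=\mathrm{Hom}_{\mathfrak h}(P_a,\mathrm{Hom}_{\mathfrak n}(Q_b,M))$, $a,b\ge 0$, with $d_hf=f\circ d_P$ and $d_vf=(-1)^a d'\circ f$, where $d'$ is the differential of $\mathrm{Hom}_{\mathfrak n}(Q,M)$ induced by that of $Q$. Its total complex $T^n=\bigoplus_{a+b=n}C^{a,b}$, $D=d_h+d_v$, is filtered by columns, $F^pT^n=\bigoplus_{a+b=n,\,a\ge p}C^{a,b}$, and the Hochschild–Serre spectral sequence $E_2^{p,q}=\mathrm H^p(\mathfrak h,\mathrm H^q(\mathfrak n,M))\Rightarrow \mathrm H^{p+q}(\mathfrak g,M)$ is the spectral sequence of this filtered complex: with $$Z_r^{p,q}=F^pT^{p+q}\cap D^{-1}(F^{p+r}T^{p+q+1}),\qquad B_r^{p,q}=F^pT^{p+q}\cap D(F^{p-r}T^{p+q-1}),$$ $$E_r^{p,q}=Z_r^{p,q}/(Z_{r-1}^{p+1,q-1}+B_{r-1}^{p,q}),$$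 and $d_r^{p,q}:E_r^{p,q}\to E_r^{p+r,q-r+1}$ is induced by $D$. From the second page on it is independent of $P$ and $Q$. **Theorem.** Let $q\ge 0$. Suppose that $\mathfrak h$ acts compatibly on a free $U(\mathfrak n)$-resolution $F$ of $k$ such that the differential $$d^{q-1}:\mathrm{Hom}_{\mathfrak n}(F_{q-1},M)\to\mathrm{Hom}_{\mathfrak n}(F_q,M)$$ is zero (with $F_{-1}=0$). Then, for every choice of $P$ and $Q$, the differentials $d_r^{p,q}$ and $d_r^{p,q+r-2}$ of the Hochschild–Serre spectral sequence are zero for all $p\in\mathbb Z$ and all $r\ge 2$. -/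

import Mathlib

namespace HS

universe u v

attribute [local instance 100] LieRing.ofAssociativeRing LieAlgebra.ofAssociativeAlgebra

/-! ### Modules over Lie algebras and free resolutions -/

section Modules

/-- The canonical `U(L)`-module structure on an `L`-module. -/
@[reducible] noncomputable def ueaModule (k L X : Type*) [Field k] [LieRing L] [LieAlgebra k L]
    [AddCommGroup X] [Module k X] [LieRingModule L X] [LieModule k L X] :
    Module (UniversalEnvelopingAlgebra k L) X :=
  Module.compHom X
    (UniversalEnvelopingAlgebra.lift k (LieModule.toEnd k L X)).toRingHom

/-- The `L`-module `X` is free as a `U(L)`-module. -/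
def IsFreeLieModule (k L X : Type*) [Field k] [LieRing L] [LieAlgebra k L]
    [AddCommGroup X] [Module k X] [LieRingModule L X] [LieModule k L X] : Prop :=
  @Module.Free (UniversalEnvelopingAlgebra k L) X _ _ (ueaModule k L X)

end Modules

/-- A free `U(L)`-resolution `⋯ → X 2 → X 1 → X 0 → k → 0` of the trivial `L`-module `k`. -/
structure FreeResolution (k : Type*) [Field k] (L : Type*) [LieRing L] [LieAlgebra k L] where
  X : ℕ → Type v
  [addCommGroup : ∀ n, AddCommGroup (X n)]
  [module : ∀ n, Module k (X n)]
  [lieRingModule : ∀ n, LieRingModule L (X n)]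
  [lieModule : ∀ n, LieModule k L (X n)]
  /-- the differential -/
  d : ∀ n, X (n + 1) →ₗ⁅k, L⁆ X n
  /-- the augmentation -/
  ε : X 0 →ₗ[k] k
  /-- the augmentation is `L`-linear for the trivial action on `k` -/
  ε_lie : ∀ (x : L) (m : X 0), ε ⁅x, m⁆ = 0
  ε_surjective : Function.Surjective ε
  exact_zero : Function.Exact (d 0) ε
  exact_succ : ∀ n, Function.Exact (d (n + 1)) (d n)
  free : ∀ n, IsFreeLieModule k L (X n)

attribute [instance] FreeResolution.addCommGroup FreeResolution.module
  FreeResolution.lieRingModule FreeResolution.lieModule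

/-! ### Filtered cochain complexes and their spectral sequences -/

/-- A cochain complex of `k`-vector spaces with a decreasing filtration by subcomplexes. The
complex is given as an ambient space `T` with an endomorphism `D` of square zero;
`Fil p n` is the `p`-th filtration piece of the part of degree `n`. -/
structure FilteredComplex (k : Type*) [Field k] where
  T : Type u
  [addCommGroup : AddCommGroup T]
  [module : Module k T]
  D : T →ₗ[k] T
  D_D : ∀ x, D (D x) = 0
  Fil : ℤ → ℤ → Submodule k T
  Fil_anti : ∀ p n, Fil (p + 1) n ≤ Fil p n
  D_mem : ∀ p n x, x ∈ Fil p n → D x ∈ Fil p (n + 1)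

attribute [instance] FilteredComplex.addCommGroup FilteredComplex.module

namespace FilteredComplex

variable {k : Type*} [Field k] (K : FilteredComplex k)

/-- `Z_r^{p,q} = F^p T^{p+q} ∩ D⁻¹(F^{p+r} T^{p+q+1})`. -/
def Z (r p q : ℤ) : Submodule k K.T :=
  K.Fil p (p + q) ⊓ (K.Fil (p + r) (p + q + 1)).comap K.D

/-- `B_r^{p,q} = F^p T^{p+q} ∩ D(F^{p-r} T^{p+q-1})`. -/
def B (r p q : ℤ) : Submodule k K.T :=
  K.Fil p (p + q) ⊓ (K.Fil (p - r) (p + q - 1)).map K.D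

/-- `Z_{r-1}^{p+1,q-1} + B_{r-1}^{p,q}` as a subspace of `Z_r^{p,q}`. -/
def denom (r p q : ℤ) : Submodule k (K.Z r p q) :=
  (K.Z (r - 1) (p + 1) (q - 1) ⊔ K.B (r - 1) p q).comap (K.Z r p q).subtype

/-- The term `E_r^{p,q} = Z_r^{p,q} / (Z_{r-1}^{p+1,q-1} + B_{r-1}^{p,q})` of the spectral
sequence of a filtered complex. -/
abbrev E (r p q : ℤ) : Type _ := K.Z r p q ⧸ K.denom r p q

theorem D_mem_Z (r p q : ℤ) (x : K.T) (hx : x ∈ K.Z r p q) :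
    K.D x ∈ K.Z r (p + r) (q - r + 1) := by
  refine ⟨?_, ?_⟩
  · have h : K.D x ∈ K.Fil (p + r) (p + q + 1) := hx.2
    rwa [show p + q + 1 = p + r + (q - r + 1) by ring] at h
  · change K.D (K.D x) ∈ K.Fil (p + r + r) (p + r + (q - r + 1) + 1)
    rw [K.D_D]
    exact Submodule.zero_mem _

/-- The restriction `Z_r^{p,q} → Z_r^{p+r,q-r+1}` of the differential `D`. -/
def DZ (r p q : ℤ) : K.Z r p q →ₗ[k] K.Z r (p + r) (q - r + 1) :=
  K.D.restrict (K.D_mem_Z r p q)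

theorem denom_le (r p q : ℤ) :
    K.denom r p q ≤ (K.denom r (p + r) (q - r + 1)).comap (K.DZ r p q) := by
  rintro ⟨x, hx⟩ h
  obtain ⟨y, hy, z, hz, hyz⟩ := Submodule.mem_sup.mp (Submodule.mem_comap.mp h)
  have hxyz : x = y + z := hyz.symm
  have hDz : K.D z = 0 := by
    obtain ⟨w, -, rfl⟩ := hz.2
    exact K.D_D w
  have hDx : K.D x = K.D y := by rw [hxyz, map_add, hDz, add_zero]
  refine Submodule.mem_comap.mpr (Submodule.mem_sup_right ⟨(K.D_mem_Z r p q x hx).1, ?_⟩)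
  refine ⟨y, ?_, hDx.symm⟩
  have hy1 := hy.1
  rwa [show p + 1 = p + r - (r - 1) by ring,
    show p + r - (r - 1) + (q - 1) = p + r + (q - r + 1) - 1 by ring] at hy1

/-- The differential `d_r^{p,q} : E_r^{p,q} → E_r^{p+r,q-r+1}` induced by `D`. -/
def d (r p q : ℤ) : K.E r p q →ₗ[k] K.E r (p + r) (q - r + 1) :=
  Submodule.mapQ _ _ (K.DZ r p q) (K.denom_le r p q)

end FilteredComplex

/-! ### Double complexes and the filtration by columns -/

/-- A first quadrant double complex with anticommuting differentials. -/
structure DoubleComplex (k : Type*) [Field k] where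
  C : ℕ → ℕ → Type u
  [addCommGroup : ∀ a b, AddCommGroup (C a b)]
  [module : ∀ a b, Module k (C a b)]
  dh : ∀ a b, C a b →ₗ[k] C (a + 1) b
  dv : ∀ a b, C a b →ₗ[k] C a (b + 1)
  dh_dh : ∀ a b x, dh (a + 1) b (dh a b x) = 0
  dv_dv : ∀ a b x, dv a (b + 1) (dv a b x) = 0
  dh_dv : ∀ a b x, dh a (b + 1) (dv a b x) + dv (a + 1) b (dh a b x) = 0

attribute [instance] DoubleComplex.addCommGroup DoubleComplex.module

namespace DoubleComplex

variable {k : Type*} [Field k] (A : DoubleComplex k)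

/-- The component in `C^{a,b}` of `d_h x`. -/
def hPart (x : ∀ a b, A.C a b) : ∀ a b, A.C a b
  | 0, _ => 0
  | a + 1, b => A.dh a b (x a b)

/-- The component in `C^{a,b}` of `d_v x`. -/
def vPart (x : ∀ a b, A.C a b) : ∀ a b, A.C a b
  | _, 0 => 0
  | a, b + 1 => A.dv a b (x a b)

/-- The total differential `d_h + d_v` on families `(x_{a,b})`. -/
def totalD : (∀ a b, A.C a b) →ₗ[k] (∀ a b, A.C a b) where
  toFun x a b := A.hPart x a b + A.vPart x a b
  map_add' x y := by
    funext a b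
    rcases a with _ | a <;> rcases b with _ | b <;> simp only [hPart, vPart, Pi.add_apply, map_add] <;> abel
  map_smul' c x := by
    funext a b
    rcases a with _ | a <;> rcases b with _ | b <;> simp [hPart, vPart]

/-- `F^p Tot^n = ⨁_{a+b=n, a≥p} C^{a,b}`: the families supported at the positions `(a, b)` with
`a + b = n` and `a ≥ p`. There are finitely many such positions. -/
def columnFil (p n : ℤ) : Submodule k (∀ a b, A.C a b) where
  carrier := {x | ∀ a b : ℕ, ¬ ((a : ℤ) + b = n ∧ p ≤ a) → x a b = 0}
  add_mem' := by
    intro x y hx hy a b h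
    simp [hx a b h, hy a b h]
  zero_mem' := by
    intro a b _
    rfl
  smul_mem' := by
    intro c x hx a b h
    simp [hx a b h]

/-- The total complex of a double complex, filtered by columns. -/
def total : FilteredComplex k where
  T := ∀ a b, A.C a b
  D := A.totalD
  D_D x := by
    funext a b
    rcases a with _ | _ | a <;> rcases b with _ | _ | b <;>
      simp [totalD, hPart, vPart, A.dh_dh, A.dv_dv, A.dh_dv]
  Fil := A.columnFil
  Fil_anti p n x hx a b h := hx a b (fun h' => h ⟨h'.1, by omega⟩)
  D_mem p n x hx a b h := by
    have e : ∀ a b : ℕ, ¬ ((a : ℤ) + b = n ∧ p ≤ a) → x a b = 0 := hx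
    have h1 : A.hPart x a b = 0 := by
      rcases a with _ | a
      · rfl
      · have : x a b = 0 := e a b (fun h' => h ⟨by push_cast; omega, by push_cast; omega⟩)
        simp [hPart, this]
    have h2 : A.vPart x a b = 0 := by
      rcases b with _ | b
      · rfl
      · have : x a b = 0 := e a b (fun h' => h ⟨by push_cast; omega, by omega⟩)
        simp [vPart, this]
    change A.hPart x a b + A.vPart x a b = 0
    rw [h1, h2, add_zero]

end DoubleComplex

/-! ### The Hochschild–Serre spectral sequence -/

section HochschildSerre

variable {k : Type*} [Field k]
  {n : Type*} [LieRing n] [LieAlgebra k n]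
  {g : Type*} [LieRing g] [LieAlgebra k g]
  {h : Type*} [LieRing h] [LieAlgebra k h]

/-- `Hom_n(X, M)` for an `n`-module `X` and a `g`-module `M`, which is an `n`-module through
`i : n → g`. -/
def HomN (i : n →ₗ⁅k⁆ g) (X M : Type*)
    [AddCommGroup X] [Module k X] [LieRingModule n X] [LieModule k n X]
    [AddCommGroup M] [Module k M] [LieRingModule g M] [LieModule k g M] :
    Submodule k (X →ₗ[k] M) where
  carrier := {f | ∀ (s : n) (m : X), f ⁅s, m⁆ = ⁅i s, f m⁆}
  add_mem' := by
    intro f f' hf hf' s m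
    simp [hf s m, hf' s m]
  zero_mem' := by
    intro s m
    simp
  smul_mem' := by
    intro c f hf s m
    simp [hf s m]

/-- `Hom_n(X, M)` for two `g`-modules `X` and `M`, both restricted along `i : n → g`. -/
def HomRes (i : n →ₗ⁅k⁆ g) (X M : Type*)
    [AddCommGroup X] [Module k X] [LieRingModule g X] [LieModule k g X]
    [AddCommGroup M] [Module k M] [LieRingModule g M] [LieModule k g M] :
    Submodule k (X →ₗ[k] M) where
  carrier := {f | ∀ (s : n) (m : X), f ⁅i s, m⁆ = ⁅i s, f m⁆}
  add_mem' := by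
    intro f f' hf hf' s m
    simp [hf s m, hf' s m]
  zero_mem' := by
    intro s m
    simp
  smul_mem' := by
    intro c f hf s m
    simp [hf s m]

/-- For an extension with middle term `g` and kernel `n`, the subspace `Hom_n(X, M)` of
`Hom_k(X, M)` is stable under the action `⁅x, f⁆ m = ⁅x, f m⁆ - f ⁅x, m⁆` of `g`. -/
theorem lie_mem_homRes (i : n →ₗ⁅k⁆ g) (π : g →ₗ⁅k⁆ h) [LieAlgebra.IsExtension i π]
    {X M : Type*}
    [AddCommGroup X] [Module k X] [LieRingModule g X] [LieModule k g X]
    [AddCommGroup M] [Module k M] [LieRingModule g M] [LieModule k g M]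
    (x : g) (f : X →ₗ[k] M) (hf : f ∈ HomRes i X M) : ⁅x, f⁆ ∈ HomRes i X M := by
  have hf' : ∀ (s : n) (m : X), f ⁅i s, m⁆ = ⁅i s, f m⁆ := hf
  have hex : Function.Exact i π :=
    (LieHom.range_eq_ker_iff i π).mp (LieAlgebra.IsExtension.exact (i := i) (p := π))
  intro s m
  obtain ⟨t, ht⟩ : ∃ t, i t = ⁅x, i s⁆ := by
    refine (hex _).mp ?_
    rw [LieHom.map_lie, hex.apply_apply_eq_zero, lie_zero]
  have e1 : ⁅x, ⁅i s, m⁆⁆ = ⁅i t, m⁆ + ⁅i s, ⁅x, m⁆⁆ := by rw [ht, leibniz_lie]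
  have e2 : ⁅x, ⁅i s, f m⁆⁆ = ⁅i t, f m⁆ + ⁅i s, ⁅x, f m⁆⁆ := by rw [ht, leibniz_lie]
  rw [LieHom.lie_apply, LieHom.lie_apply, e1, hf', e2, map_add, hf', hf', lie_sub]
  abel

/-- The subalgebra `n` acts by zero on `Hom_n(X, M)`, so that the action of `g` is an action of
`h = g/n`. -/
theorem lie_homRes_eq_zero (i : n →ₗ⁅k⁆ g) {X M : Type*}
    [AddCommGroup X] [Module k X] [LieRingModule g X] [LieModule k g X]
    [AddCommGroup M] [Module k M] [LieRingModule g M] [LieModule k g M]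
    (s : n) (f : X →ₗ[k] M) (hf : f ∈ HomRes i X M) : ⁅i s, f⁆ = 0 := by
  have hf' : ∀ (s : n) (m : X), f ⁅i s, m⁆ = ⁅i s, f m⁆ := hf
  ext m
  rw [LieHom.lie_apply, hf', sub_self, LinearMap.zero_apply]

/-- `Hom_h(Y, Hom_n(X, M))` for an `h`-module `Y` and `g`-modules `X`, `M`: the linear maps `f`
from `Y` to `Hom_k(X, M)` that take values in `Hom_n(X, M)` and are `h`-linear, where an element
of `h` acts on `Hom_n(X, M)` through any element `x` of `g` over it. -/
def HomHN (i : n →ₗ⁅k⁆ g) (π : g →ₗ⁅k⁆ h) (Y X M : Type*)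
    [AddCommGroup Y] [Module k Y] [LieRingModule h Y] [LieModule k h Y]
    [AddCommGroup X] [Module k X] [LieRingModule g X] [LieModule k g X]
    [AddCommGroup M] [Module k M] [LieRingModule g M] [LieModule k g M] :
    Submodule k (Y →ₗ[k] X →ₗ[k] M) where
  carrier := {f | (∀ y : Y, f y ∈ HomRes i X M) ∧ ∀ (x : g) (y : Y), f ⁅π x, y⁆ = ⁅x, f y⁆}
  add_mem' := by
    intro f f' hf hf'
    exact ⟨fun y => add_mem (hf.1 y) (hf'.1 y), fun x y => by
      rw [LinearMap.add_apply, LinearMap.add_apply, hf.2, hf'.2, lie_add]⟩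
  zero_mem' := ⟨fun y => zero_mem _, fun x y => by
    rw [LinearMap.zero_apply, LinearMap.zero_apply, lie_zero]⟩
  smul_mem' := by
    intro c f hf
    exact ⟨fun y => Submodule.smul_mem _ c (hf.1 y), fun x y => by
      rw [LinearMap.smul_apply, LinearMap.smul_apply, hf.2, lie_smul]⟩

/-- The map `Hom_h(Y, Hom_n(X, M)) → Hom_h(Y', Hom_n(X', M))`, `f ↦ (y ↦ f (φ y) ∘ ψ)`, induced
by a map `φ : Y' → Y` of `h`-modules and a map `ψ : X' → X` of `g`-modules. -/
def homHNMap (i : n →ₗ⁅k⁆ g) (π : g →ₗ⁅k⁆ h) {Y Y' X X' : Type*} (M : Type*)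
    [AddCommGroup Y] [Module k Y] [LieRingModule h Y] [LieModule k h Y]
    [AddCommGroup Y'] [Module k Y'] [LieRingModule h Y'] [LieModule k h Y']
    [AddCommGroup X] [Module k X] [LieRingModule g X] [LieModule k g X]
    [AddCommGroup X'] [Module k X'] [LieRingModule g X'] [LieModule k g X']
    [AddCommGroup M] [Module k M] [LieRingModule g M] [LieModule k g M]
    (φ : Y' →ₗ⁅k, h⁆ Y) (ψ : X' →ₗ⁅k, g⁆ X) : HomHN i π Y X M →ₗ[k] HomHN i π Y' X' M where
  toFun f := ⟨(f : Y →ₗ[k] X →ₗ[k] M).compl₁₂ (φ : Y' →ₗ[k] Y) (ψ : X' →ₗ[k] X), by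
    obtain ⟨f, hf1, hf2⟩ := f
    refine ⟨fun y s m => ?_, fun x y => ?_⟩
    · have := hf1 (φ y) s (ψ m)
      simpa using this
    · ext m
      have := LinearMap.congr_fun (hf2 x (φ y)) (ψ m)
      simpa using this⟩
  map_add' f f' := by
    ext y m
    rfl
  map_smul' c f := by
    ext y m
    rfl

/-- The double complex `C^{a,b} = Hom_h(P_a, Hom_n(Q_b, M))` with
`d_h f = f ∘ d_P` and `d_v f = (-1)^a d' ∘ f`, where `d'` is the differential of the cochain
complex `Hom_n(Q, M)` of `h`-modules. -/
def hsDouble (i : n →ₗ⁅k⁆ g) (π : g →ₗ⁅k⁆ h)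
    (M : Type*) [AddCommGroup M] [Module k M] [LieRingModule g M] [LieModule k g M]
    (P : FreeResolution k h) (Q : FreeResolution k g) : DoubleComplex k where
  C a b := HomHN i π (P.X a) (Q.X b) M
  dh a b := homHNMap i π M (P.d a) (LieModuleHom.id : Q.X b →ₗ⁅k, g⁆ Q.X b)
  dv a b := (-1 : k) ^ a • homHNMap i π M (LieModuleHom.id : P.X a →ₗ⁅k, h⁆ P.X a) (Q.d b)
  dh_dh a b f := by
    ext y z
    have : P.d a (P.d (a + 1) y) = 0 := (P.exact_succ a).apply_apply_eq_zero y
    change (f : P.X a →ₗ[k] Q.X b →ₗ[k] M) (P.d a (P.d (a + 1) y)) z = 0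
    rw [this, map_zero, LinearMap.zero_apply]
  dv_dv a b f := by
    ext y z
    have : Q.d b (Q.d (b + 1) z) = 0 := (Q.exact_succ b).apply_apply_eq_zero z
    change (-1 : k) ^ a • (-1 : k) ^ a •
      (f : P.X a →ₗ[k] Q.X b →ₗ[k] M) y (Q.d b (Q.d (b + 1) z)) = 0
    rw [this, map_zero, smul_zero, smul_zero]
  dh_dv a b f := by
    ext y z
    change (-1 : k) ^ a • (f : P.X a →ₗ[k] Q.X b →ₗ[k] M) (P.d a y) (Q.d b z)
      + (-1 : k) ^ (a + 1) • (f : P.X a →ₗ[k] Q.X b →ₗ[k] M) (P.d a y) (Q.d b z) = 0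
    rw [pow_succ, mul_neg_one, neg_smul, add_neg_cancel]

/-- The Hochschild–Serre spectral sequence of the extension `0 → n → g → h → 0` with coefficients
in the `g`-module `M`: the spectral sequence of the total complex of `Hom_h(P, Hom_n(Q, M))`
filtered by columns, with `E_2^{p,q} = H^p(h, H^q(n, M)) ⇒ H^{p+q}(g, M)`. Here `P` and `Q` are
free resolutions of `k` over `U(h)` and over `U(g)`; from the second page on, the spectral
sequence does not depend on them. -/
abbrev hochschildSerre (i : n →ₗ⁅k⁆ g) (π : g →ₗ⁅k⁆ h) [LieAlgebra.IsExtension i π]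
    (M : Type*) [AddCommGroup M] [Module k M] [LieRingModule g M] [LieModule k g M]
    (P : FreeResolution k h) (Q : FreeResolution k g) : FilteredComplex k :=
  (hsDouble i π M P Q).total

/-- The differential `d^b : Hom_n(F_b, M) → Hom_n(F_{b+1}, M)`, for a free `U(n)`-resolution
`F`. -/
def homDiff (i : n →ₗ⁅k⁆ g) (F : FreeResolution k n)
    (M : Type*) [AddCommGroup M] [Module k M] [LieRingModule g M] [LieModule k g M] (b : ℕ) :
    HomN i (F.X b) M →ₗ[k] HomN i (F.X (b + 1)) M :=
  (LinearMap.lcomp k M (F.d b : F.X (b + 1) →ₗ[k] F.X b)).restrict (by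
    intro f hf s m
    have hf' : ∀ (s : n) (m : F.X b), f ⁅s, m⁆ = ⁅i s, f m⁆ := hf
    change f (F.d b ⁅s, m⁆) = ⁅i s, f (F.d b m)⁆
    rw [LieModuleHom.map_lie, hf'])

/-- A compatible action of `h` on a free `U(n)`-resolution `F`, for an extension of `h` by `n` with
middle term `g`, inclusion `i` and Lie algebra section `σ`: a Lie algebra homomorphism from `h` to
the `k`-linear chain endomorphisms of `F` that extend the zero map on `k`, such that
`α(s) f = Θ_α (s f) - s (Θ_α f)`. Here `α(s)` is the element `t` of `n` with
`i t = [σ α, i s]`. -/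
structure CompatibleAction (i : n →ₗ⁅k⁆ g) (σ : h →ₗ⁅k⁆ g) (F : FreeResolution k n) where
  Θ : ∀ b, h →ₗ⁅k⁆ Module.End k (F.X b)
  comm_d : ∀ b α f, F.d b (Θ (b + 1) α f) = Θ b α (F.d b f)
  ε_zero : ∀ α f, F.ε (Θ 0 α f) = 0
  compat : ∀ b α s t (f : F.X b), i t = ⁅σ α, i s⁆ → ⁅t, f⁆ = Θ b α ⁅s, f⁆ - ⁅s, Θ b α f⁆

end HochschildSerre

end HS

/-!
The compatible action makes `F` a complex of `g`-modules: `x ∈ g` acts by its `n`-component plus the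
compatible action of `π x` (`CompatibleAction.lieResolution`). So there is a double complex
`A = Hom_h(P, Hom_n(F, M))`, and a comparison map of `g`-modules `φ : Q → F` over `k` induces a map
from `A` to the Hochschild–Serre double complex `Hom_h(P, Hom_n(Q, M))`.

*The vanishing for `A`.* The hypothesis says that the vertical differential of `A` from row `q - 1`
to row `q` is zero, so that the truncation `τ` to the rows `≥ q` is a chain map of the total complex
(`totalD_rowTruncation`). For `x` in `Z_r^{p,s}` with `q ≤ s ≤ q + r - 2`, the element `D x` lives
in rows `< q`, hence `D (τ x) = τ (D x) = 0`, while `x - τ x` lies in `F^{p+1}`; therefore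
`d_r [x] = 0` (`exists_mem_columnFil_of_dv_eq_zero`). The two differentials of the theorem are the
cases `s = q` and `s = q + r - 2`.

*The transfer.* The map `A → Hom_h(P, Hom_n(Q, M))` has an exact mapping cone in each column. This
holds since `cone(φ)` is an exact complex of projective `U(n)`-modules (`homRes_cone_exact`), and
since `Hom_h(P_a, -)` is exact (`homHN_cone_exact`). The projectivity of `Q_b` over `U(n)` is
obtained from the surjection of `g`-modules `F_0 ⊗ Q_b → Q_b`, which splits, and from
`Hom_n(F_0 ⊗ Q_b, Y) = Hom_n(F_0, Hom_k(Q_b, Y))` (`LieProjective.restrict`). By induction on `r`,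
the cone of the induced map on `F^p / F^{p+r}` is exact (`ConeExact.of_one`); surjectivity on the
cohomology of these quotients is surjectivity on `E_r`, which is all that the transfer requires
(`ConeExact.exists_of_exists`).
-/

namespace HS

open TensorProduct

attribute [local instance 100] LieRing.ofAssociativeRing LieAlgebra.ofAssociativeAlgebra

universe v

/-! ### Projective modules over Lie algebras -/

/-- The lifting property of projective `U(L)`-modules, in terms of `L`-modules: an `L`-linear map
out of `X` lifts through `d` as soon as it does so pointwise. The map `d` need not be surjective.
The universes are those of the test modules. -/
def LieProjective.{w₁, w₂} (k L X : Type*) [Field k] [LieRing L] [LieAlgebra k L]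
    [AddCommGroup X] [Module k X] [LieRingModule L X] [LieModule k L X] : Prop :=
  ∀ (Y : Type w₁) (Z : Type w₂)
    [AddCommGroup Y] [Module k Y] [LieRingModule L Y] [LieModule k L Y]
    [AddCommGroup Z] [Module k Z] [LieRingModule L Z] [LieModule k L Z]
    (d : Y →ₗ⁅k, L⁆ Z) (f : X →ₗ⁅k, L⁆ Z), (∀ x, ∃ y, d y = f x) →
    ∃ t : X →ₗ⁅k, L⁆ Y, ∀ x, d (t x) = f x

section Free

variable {k L X Y : Type*} [Field k] [LieRing L] [LieAlgebra k L]
  [AddCommGroup X] [Module k X] [LieRingModule L X] [LieModule k L X]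
  [AddCommGroup Y] [Module k Y] [LieRingModule L Y] [LieModule k L Y]

theorem ueaModule_ι_smul (x : L) (m : X) :
    letI := ueaModule k L X
    UniversalEnvelopingAlgebra.ι k x • m = ⁅x, m⁆ := by
  change UniversalEnvelopingAlgebra.lift k (LieModule.toEnd k L X)
    (UniversalEnvelopingAlgebra.ι k x) m = ⁅x, m⁆
  rw [UniversalEnvelopingAlgebra.lift_ι_apply]
  rfl

theorem ueaModule_algebraMap_smul (c : k) (m : X) :
    letI := ueaModule k L X
    algebraMap k (UniversalEnvelopingAlgebra k L) c • m = c • m := by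
  change UniversalEnvelopingAlgebra.lift k (LieModule.toEnd k L X)
    (algebraMap k (UniversalEnvelopingAlgebra k L) c) m = c • m
  rw [AlgHom.commutes]
  rfl

theorem map_ueaModule_smul (f : X →ₗ⁅k, L⁆ Y) (u : UniversalEnvelopingAlgebra k L) (m : X) :
    letI := ueaModule k L X
    letI := ueaModule k L Y
    f (u • m) = u • f m := by
  let := ueaModule k L X
  let := ueaModule k L Y
  -- The elements that commute with `f` form a subalgebra that contains `L`.
  let S : Subalgebra k (UniversalEnvelopingAlgebra k L) :=
    { carrier := {u | ∀ m : X, f (u • m) = u • f m}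
      mul_mem' := fun {a b} ha hb m => by rw [mul_smul, ha, hb, mul_smul]
      add_mem' := fun {a b} ha hb m => by rw [add_smul, map_add, ha, hb, add_smul]
      algebraMap_mem' := fun c m => by
        rw [ueaModule_algebraMap_smul, ueaModule_algebraMap_smul, map_smul] }
  have hι : ∀ x : L, UniversalEnvelopingAlgebra.ι k x ∈ S := fun x m => by
    rw [ueaModule_ι_smul, ueaModule_ι_smul, LieModuleHom.map_lie]
  let ι' : L →ₗ⁅k⁆ S :=
    { toFun := fun x => ⟨UniversalEnvelopingAlgebra.ι k x, hι x⟩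
      map_add' := fun x y => by ext; simp
      map_smul' := fun c x => by ext; simp
      map_lie' := fun {x y} => by
        ext
        simp [LieRing.of_associative_ring_bracket] }
  have key : S.val.comp (UniversalEnvelopingAlgebra.lift k ι') = AlgHom.id k _ := by
    apply UniversalEnvelopingAlgebra.hom_ext
    ext x
    change (UniversalEnvelopingAlgebra.lift k ι' (UniversalEnvelopingAlgebra.ι k x) :
      UniversalEnvelopingAlgebra k L) = UniversalEnvelopingAlgebra.ι k x
    rw [UniversalEnvelopingAlgebra.lift_ι_apply]
    rfl
  have hu : (UniversalEnvelopingAlgebra.lift k ι' u : UniversalEnvelopingAlgebra k L) = u :=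
    DFunLike.congr_fun key u
  rw [← hu]
  exact (UniversalEnvelopingAlgebra.lift k ι' u).2 m

theorem IsFreeLieModule.lieProjective.{w₁, w₂} (hX : IsFreeLieModule k L X) :
    LieProjective.{w₁, w₂} k L X := by
  intro Y Z _ _ _ _ _ _ _ _ d f hf
  let := ueaModule k L X
  let := ueaModule k L Y
  let := ueaModule k L Z
  have : Module.Free (UniversalEnvelopingAlgebra k L) X := hX
  let b := Module.Free.chooseBasis (UniversalEnvelopingAlgebra k L) X
  choose y hy using fun j => hf (b j)
  let t := b.constr ℕ y
  let t' : X →ₗ⁅k, L⁆ Y :=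
    { toFun := t
      map_add' := map_add t
      map_smul' := fun c m => by
        rw [← ueaModule_algebraMap_smul (L := L), map_smul, ueaModule_algebraMap_smul]
        rfl
      map_lie' := fun {x m} => by
        rw [← ueaModule_ι_smul (k := k)]
        rw [map_smul, ueaModule_ι_smul] }
  let dt : X →ₗ[UniversalEnvelopingAlgebra k L] Z :=
    { toFun := fun x => d (t' x)
      map_add' := by simp
      map_smul' := fun u m => map_ueaModule_smul (d.comp t') u m }
  let f' : X →ₗ[UniversalEnvelopingAlgebra k L] Z :=
    { toFun := f
      map_add' := by simp
      map_smul' := fun u m => map_ueaModule_smul f u m }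
  have key : dt = f' := b.ext fun j => by
    change d (t (b j)) = f (b j)
    rw [b.constr_basis, hy]
  exact ⟨t', fun x => LinearMap.congr_fun key x⟩

end Free

/-! ### Products of Lie modules -/

section Prod

variable {k L X Y : Type*} [Field k] [LieRing L] [LieAlgebra k L]
  [AddCommGroup X] [Module k X] [LieRingModule L X] [LieModule k L X]
  [AddCommGroup Y] [Module k Y] [LieRingModule L Y] [LieModule k L Y]

instance prodLieRingModule : LieRingModule L (X × Y) where
  bracket x m := (⁅x, m.1⁆, ⁅x, m.2⁆)
  add_lie x y m := by ext <;> exact add_lie _ _ _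
  lie_add x m m' := by ext <;> exact lie_add _ _ _
  leibniz_lie x y m := by ext <;> exact leibniz_lie _ _ _

theorem prod_lie (x : L) (m : X × Y) : ⁅x, m⁆ = (⁅x, m.1⁆, ⁅x, m.2⁆) := rfl

instance prodLieModule : LieModule k L (X × Y) where
  smul_lie c x m := by ext <;> exact smul_lie _ _ _
  lie_smul c x m := by ext <;> exact lie_smul _ _ _

variable (k L X Y) in
/-- The projection onto the first factor. -/
def lieFst : X × Y →ₗ⁅k, L⁆ X :=
  { LinearMap.fst k X Y with map_lie' := rfl }

variable (k L X Y) in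
/-- The projection onto the second factor. -/
def lieSnd : X × Y →ₗ⁅k, L⁆ Y :=
  { LinearMap.snd k X Y with map_lie' := rfl }

variable (k L X Y) in
/-- The inclusion of the first factor. -/
def lieInl : X →ₗ⁅k, L⁆ X × Y :=
  { LinearMap.inl k X Y with map_lie' := fun {x m} => by simp [prod_lie] }

variable (k L X Y) in
/-- The inclusion of the second factor. -/
def lieInr : Y →ₗ⁅k, L⁆ X × Y :=
  { LinearMap.inr k X Y with map_lie' := fun {x m} => by simp [prod_lie] }

/-- The map into a product with given components. -/
def lieProd {W : Type*} [AddCommGroup W] [Module k W] [LieRingModule L W]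
    (f : W →ₗ⁅k, L⁆ X) (f' : W →ₗ⁅k, L⁆ Y) : W →ₗ⁅k, L⁆ X × Y :=
  { (f : W →ₗ[k] X).prod (f' : W →ₗ[k] Y) with
    map_lie' := fun {x m} => Prod.ext (f.map_lie x m) (f'.map_lie x m) }

theorem LieProjective.prod.{w₁, w₂} (hX : LieProjective.{w₁, w₂} k L X)
    (hY : LieProjective.{w₁, w₂} k L Y) : LieProjective.{w₁, w₂} k L (X × Y) := by
  intro A B _ _ _ _ _ _ _ _ d f hf
  obtain ⟨t₁, h₁⟩ := hX A B d (f.comp (lieInl k L X Y)) fun x => hf _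
  obtain ⟨t₂, h₂⟩ := hY A B d (f.comp (lieInr k L X Y)) fun x => hf _
  refine ⟨{ (t₁ : X →ₗ[k] A).coprod (t₂ : Y →ₗ[k] A) with
    map_lie' := fun {x m} => by simp [prod_lie] }, fun m => ?_⟩
  change d (t₁ m.1 + t₂ m.2) = f m
  rw [map_add, h₁, h₂]
  change f (m.1, 0) + f (0, m.2) = f m
  rw [← map_add]
  simp

end Prod

/-! ### Restriction of projective modules to a subalgebra -/

section ResProjective

universe w₁ w₂ w₃ w₄

variable {k : Type*} [Field k] {n : Type*} [LieRing n] [LieAlgebra k n]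
  {g : Type*} [LieRing g] [LieAlgebra k g]

/-- Suppose that some `g`-module `A` that is projective over `n` admits a `g`-linear surjection `ε`
onto `k`. Then every projective `g`-module `X` is projective over `n`: it is a direct summand of
`A ⊗ X`, and `Hom_n(A ⊗ X, Y) = Hom_n(A, Hom_k(X, Y))`. This takes the place of the
Poincaré–Birkhoff–Witt theorem. -/
theorem LieProjective.restrict (i : n →ₗ⁅k⁆ g) {A : Type w₃} {X : Type w₄}
    [AddCommGroup A] [Module k A] [LieRingModule g A] [LieModule k g A]
    [LieRingModule n A] [LieModule k n A]
    [AddCommGroup X] [Module k X] [LieRingModule g X] [LieModule k g X]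
    [LieRingModule n X] [LieModule k n X]
    (hiA : ∀ (s : n) (a : A), ⁅i s, a⁆ = ⁅s, a⁆) (hiX : ∀ (s : n) (x : X), ⁅i s, x⁆ = ⁅s, x⁆)
    (hX : LieProjective.{max w₃ w₄, w₄} k g X)
    (hA : LieProjective.{max w₁ w₄, max w₂ w₄} k n A) (ε : A →ₗ[k] k)
    (hε : ∀ (x : g) (a : A), ε ⁅x, a⁆ = 0) (hε' : Function.Surjective ε) :
    LieProjective.{w₁, w₂} k n X := by
  intro Y Z _ _ _ _ _ _ _ _ d f hf
  let e : A →ₗ⁅k, g⁆ X →ₗ[k] X :=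
    { LinearMap.smulRight ε (LinearMap.id : X →ₗ[k] X) with
      map_lie' := fun {x a} => by
        ext m
        simp [hε] }
  have he : ∀ a m, e a m = ε a • m := fun a m => rfl
  obtain ⟨s, hs⟩ := hX (A ⊗[k] X) X (TensorProduct.LieModule.liftLie k g A X X e)
    LieModuleHom.id fun x => by
      obtain ⟨a, ha⟩ := hε' 1
      exact ⟨a ⊗ₜ x, by rw [TensorProduct.LieModule.liftLie_apply, he, ha, one_smul]; rfl⟩
  let fA : A →ₗ⁅k, n⁆ X →ₗ[k] Z :=
    { LinearMap.smulRight ε (f : X →ₗ[k] Z) with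
      map_lie' := fun {x a} => by
        ext m
        simp [← hiA, hε] }
  have hfA : ∀ a m, fA a m = ε a • f m := fun a m => rfl
  let dX : (X →ₗ[k] Y) →ₗ⁅k, n⁆ (X →ₗ[k] Z) :=
    { LinearMap.compRight k (d : Y →ₗ[k] Z) with
      map_lie' := fun {x a} => by
        ext m
        simp }
  have hdX : ∀ a m, dX a m = d (a m) := fun a m => rfl
  obtain ⟨T, hT⟩ := hA _ _ dX fA fun a => by
    obtain ⟨u, hu⟩ := Module.projective_lifting_property
      ((d : Y →ₗ[k] Z).rangeRestrict)
      ((f : X →ₗ[k] Z).codRestrict (LinearMap.range (d : Y →ₗ[k] Z)) fun x => hf x)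
      (LinearMap.surjective_rangeRestrict _)
    refine ⟨ε a • u, ?_⟩
    ext m
    have := congrArg Subtype.val (LinearMap.congr_fun hu m)
    rw [hfA, hdX, LinearMap.smul_apply, map_smul]
    exact congrArg _ this
  let T' : A ⊗[k] X →ₗ[k] Y := TensorProduct.lift (T : A →ₗ[k] X →ₗ[k] Y)
  have hT' : ∀ (x : n) (u : A ⊗[k] X), T' ⁅i x, u⁆ = ⁅x, T' u⁆ := by
    intro x u
    induction u with
    | zero => simp
    | add u v hu hv => simp [hu, hv]
    | tmul a m => simp [T', hiA, hiX]
  have hdT : ∀ u : A ⊗[k] X, d (T' u) = f (TensorProduct.LieModule.liftLie k g A X X e u) := by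
    intro u
    induction u with
    | zero => simp
    | add u v hu hv => rw [map_add, map_add, map_add, map_add, hu, hv]
    | tmul a m =>
      rw [TensorProduct.LieModule.liftLie_apply, he, map_smul, ← hfA, ← hT]
      rfl
  refine ⟨{ T' ∘ₗ (s : X →ₗ[k] A ⊗[k] X) with
    map_lie' := fun {x m} => ?_ }, fun m => ?_⟩
  · change T' (s ⁅x, m⁆) = ⁅x, T' (s m)⁆
    rw [← hiX, LieModuleHom.map_lie, hT']
  · change d (T' (s m)) = f m
    rw [hdT, hs]
    rfl

end ResProjective

/-! ### Exactness of `Hom` on resolutions by projective modules -/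

section Split

universe w₁ w₂

variable {k L : Type*} [Field k] [LieRing L] [LieAlgebra k L]
  {A : Type w₁} [AddCommGroup A] [Module k A] [LieRingModule L A] [LieModule k L A]
  {K : ℕ → Type w₂} [∀ m, AddCommGroup (K m)] [∀ m, Module k (K m)] [∀ m, LieRingModule L (K m)]
  [∀ m, LieModule k L (K m)]
  {M : Type*} [AddCommGroup M] [Module k M] [LieRingModule L M]

/-- The differentials of an exact complex `⋯ → K 1 → K 0 → A → 0` of projective modules split. -/
theorem exists_splitting_of_exact (hA : LieProjective.{w₂, w₁} k L A)
    (hK : ∀ m, LieProjective.{w₂, w₂} k L (K m))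
    (e : K 0 →ₗ⁅k, L⁆ A) (d : ∀ m, K (m + 1) →ₗ⁅k, L⁆ K m) (he : Function.Surjective e)
    (h0 : Function.Exact (d 0) e) (hd : ∀ m, Function.Exact (d (m + 1)) (d m)) :
    (∃ s : A →ₗ⁅k, L⁆ K 0, ∃ t : K 0 →ₗ⁅k, L⁆ K 1, ∀ x, d 0 (t x) = x - s (e x)) ∧
    ∀ m, ∃ s : K m →ₗ⁅k, L⁆ K (m + 1), ∃ t : K (m + 1) →ₗ⁅k, L⁆ K (m + 2),
      ∀ x, d (m + 1) (t x) = x - s (d m x) := by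
  obtain ⟨s, hs⟩ := hA _ _ e LieModuleHom.id fun a => he a
  obtain ⟨t, ht⟩ := hK 0 _ _ (d 0) (LieModuleHom.id - s.comp e) fun x => by
    refine (h0 _).mp ?_
    change e (x - s (e x)) = 0
    rw [map_sub, hs]
    exact sub_self _
  refine ⟨⟨s, t, ht⟩, fun m => ?_⟩
  induction m with
  | zero =>
    obtain ⟨t', ht'⟩ := hK 1 _ _ (d 1) (LieModuleHom.id - t.comp (d 0)) fun x => by
      refine (hd 0 _).mp ?_
      change d 0 (x - t (d 0 x)) = 0
      rw [map_sub, ht]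
      change _ - (d 0 x - s (e (d 0 x))) = 0
      rw [h0.apply_apply_eq_zero, map_zero, sub_zero, sub_self]
    exact ⟨t, t', ht'⟩
  | succ m ih =>
    obtain ⟨s, t, ht⟩ := ih
    obtain ⟨t', ht'⟩ := hK (m + 2) _ _ (d (m + 2)) (LieModuleHom.id - t.comp (d (m + 1)))
      fun x => by
        refine (hd (m + 1) _).mp ?_
        change d (m + 1) (x - t (d (m + 1) x)) = 0
        rw [map_sub, ht, (hd m).apply_apply_eq_zero, map_zero, sub_zero, sub_self]
    exact ⟨t, t', ht'⟩

/-- The functor `Hom_L(-, M)` preserves the exactness of an exact complex `⋯ → K 1 → K 0 → A → 0`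
of projective modules. -/
theorem hom_exact_of_exact (hA : LieProjective.{w₂, w₁} k L A)
    (hK : ∀ m, LieProjective.{w₂, w₂} k L (K m))
    (e : K 0 →ₗ⁅k, L⁆ A) (d : ∀ m, K (m + 1) →ₗ⁅k, L⁆ K m) (he : Function.Surjective e)
    (h0 : Function.Exact (d 0) e) (hd : ∀ m, Function.Exact (d (m + 1)) (d m)) :
    (∀ f : K 0 →ₗ⁅k, L⁆ M, (∀ x, f (d 0 x) = 0) → ∃ f' : A →ₗ⁅k, L⁆ M, ∀ x, f x = f' (e x)) ∧
    ∀ m, ∀ f : K (m + 1) →ₗ⁅k, L⁆ M, (∀ x, f (d (m + 1) x) = 0) →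
      ∃ f' : K m →ₗ⁅k, L⁆ M, ∀ x, f x = f' (d m x) := by
  obtain ⟨⟨s, t, ht⟩, hst⟩ := exists_splitting_of_exact hA hK e d he h0 hd
  refine ⟨fun f hf => ⟨f.comp s, fun x => ?_⟩, fun m f hf => ?_⟩
  · have := hf (t x)
    rwa [ht, map_sub, sub_eq_zero] at this
  · obtain ⟨s, t, ht⟩ := hst m
    refine ⟨f.comp s, fun x => ?_⟩
    have := hf (t x)
    rwa [ht, map_sub, sub_eq_zero] at this

end Split

/-! ### Resolutions by Lie modules -/

/-- A resolution `⋯ → X 2 → X 1 → X 0 → k → 0` of the trivial module `k` by arbitrary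
`L`-modules. -/
structure LieResolution (k : Type*) [Field k] (L : Type*) [LieRing L] [LieAlgebra k L] where
  X : ℕ → Type v
  [addCommGroup : ∀ b, AddCommGroup (X b)]
  [module : ∀ b, Module k (X b)]
  [lieRingModule : ∀ b, LieRingModule L (X b)]
  [lieModule : ∀ b, LieModule k L (X b)]
  /-- the differential -/
  d : ∀ b, X (b + 1) →ₗ⁅k, L⁆ X b
  /-- the augmentation -/
  ε : X 0 →ₗ[k] k
  ε_lie : ∀ (x : L) (m : X 0), ε ⁅x, m⁆ = 0
  ε_surjective : Function.Surjective ε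
  exact_zero : Function.Exact (d 0) ε
  exact_succ : ∀ b, Function.Exact (d (b + 1)) (d b)

attribute [instance] LieResolution.addCommGroup LieResolution.module
  LieResolution.lieRingModule LieResolution.lieModule

section ChainMap

variable {k : Type*} [Field k] {L : Type*} [LieRing L] [LieAlgebra k L]

/-- The comparison map from a free resolution to any resolution. -/
theorem FreeResolution.exists_chainMap (Q : FreeResolution k L) (G : LieResolution k L) :
    ∃ φ : ∀ b, Q.X b →ₗ⁅k, L⁆ G.X b, (∀ x, G.ε (φ 0 x) = Q.ε x) ∧
      ∀ b x, G.d b (φ (b + 1) x) = φ b (Q.d b x) := by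
  let εG : G.X 0 →ₗ⁅k, L⁆ TrivialLieModule k L k :=
    { (TrivialLieModule.equiv k L k).symm.toLinearMap ∘ₗ G.ε with
      map_lie' := fun {x m} => G.ε_lie x m }
  let εQ : Q.X 0 →ₗ⁅k, L⁆ TrivialLieModule k L k :=
    { (TrivialLieModule.equiv k L k).symm.toLinearMap ∘ₗ Q.ε with
      map_lie' := fun {x m} => Q.ε_lie x m }
  obtain ⟨φ₀, hφ₀⟩ := (Q.free 0).lieProjective _ _ εG εQ fun x => G.ε_surjective (Q.ε x)
  have step : ∀ b (φ : Q.X b →ₗ⁅k, L⁆ G.X b), (∀ x, ∃ y, G.d b y = φ (Q.d b x)) →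
      ∃ φ' : Q.X (b + 1) →ₗ⁅k, L⁆ G.X (b + 1), ∀ x, G.d b (φ' x) = φ (Q.d b x) :=
    fun b φ hφ => (Q.free (b + 1)).lieProjective _ _ (G.d b) (φ.comp (Q.d b)) hφ
  choose next hnext using step
  have good₀ : ∀ x, ∃ y, G.d 0 y = φ₀ (Q.d 0 x) := fun x => by
    refine (G.exact_zero _).mp ?_
    have h1 : G.ε (φ₀ (Q.d 0 x)) = Q.ε (Q.d 0 x) := hφ₀ _
    rw [h1, Q.exact_zero.apply_apply_eq_zero]
  have good : ∀ b φ hφ x, ∃ y, G.d (b + 1) y = next b φ hφ (Q.d (b + 1) x) :=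
    fun b φ hφ x => by
      refine (G.exact_succ b _).mp ?_
      rw [hnext, (Q.exact_succ b).apply_apply_eq_zero, map_zero]
  let Φ : ∀ b, {φ : Q.X b →ₗ⁅k, L⁆ G.X b // ∀ x, ∃ y, G.d b y = φ (Q.d b x)} := fun b =>
    Nat.rec ⟨φ₀, good₀⟩ (fun b φ => ⟨next b φ.1 φ.2, good b φ.1 φ.2⟩) b
  exact ⟨fun b => (Φ b).1, hφ₀, fun b x => hnext b (Φ b).1 (Φ b).2 x⟩

end ChainMap

/-! ### The mapping cone of a map of resolutions -/

section Cone

variable {k : Type*} [Field k]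
  {n : Type*} [LieRing n] [LieAlgebra k n]
  {g : Type*} [LieRing g] [LieAlgebra k g]

/-- A map of `g`-modules, as a map of `n`-modules. -/
def restrictHom (i : n →ₗ⁅k⁆ g) {X Y : Type*}
    [AddCommGroup X] [Module k X] [LieRingModule g X] [LieRingModule n X]
    [AddCommGroup Y] [Module k Y] [LieRingModule g Y] [LieRingModule n Y]
    (hX : ∀ (s : n) (x : X), ⁅i s, x⁆ = ⁅s, x⁆) (hY : ∀ (s : n) (y : Y), ⁅i s, y⁆ = ⁅s, y⁆)
    (f : X →ₗ⁅k, g⁆ Y) : X →ₗ⁅k, n⁆ Y :=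
  { (f : X →ₗ[k] Y) with
    map_lie' := fun {s x} => by
      change f ⁅s, x⁆ = ⁅s, f x⁆
      rw [← hX, ← hY, LieModuleHom.map_lie] }

theorem mem_homRes_of_lie (i : n →ₗ⁅k⁆ g) {X M : Type*}
    [AddCommGroup X] [Module k X] [LieRingModule g X] [LieModule k g X] [LieRingModule n X]
    [AddCommGroup M] [Module k M] [LieRingModule g M] [LieModule k g M] [LieRingModule n M]
    (hX : ∀ (s : n) (x : X), ⁅i s, x⁆ = ⁅s, x⁆) (hM : ∀ (s : n) (m : M), ⁅i s, m⁆ = ⁅s, m⁆)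
    (f : X →ₗ⁅k, n⁆ M) : (f : X →ₗ[k] M) ∈ HomRes i X M := fun s m => by
  rw [hX, hM]
  exact f.map_lie s m

variable (i : n →ₗ⁅k⁆ g) (Q : FreeResolution k g) (G : LieResolution k g)
  [∀ b, LieRingModule n (G.X b)] [∀ b, LieModule k n (G.X b)]
  (M : Type*) [AddCommGroup M] [Module k M] [LieRingModule g M] [LieModule k g M]

/-- Let `φ : Q → G` be a map of resolutions by `g`-modules, where `Q` is free over `g` and `G` is
projective over `n`. The functor `Hom_n(-, M)` takes the mapping cone of `φ` to an exact complex. -/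
theorem homRes_cone_exact
    (hiG : ∀ b (s : n) (x : G.X b), ⁅i s, x⁆ = ⁅s, x⁆)
    (hG : ∀ b, IsFreeLieModule k n (G.X b))
    (φ : ∀ b, Q.X b →ₗ⁅k, g⁆ G.X b) (hφ₀ : ∀ x, G.ε (φ 0 x) = Q.ε x)
    (hφ : ∀ b x, G.d b (φ (b + 1) x) = φ b (Q.d b x)) :
    (∀ y ∈ HomRes i (G.X 0) M, (∀ m, y (G.d 0 m) = 0) → (∀ m, y (φ 0 m) = 0) → y = 0) ∧
    (∀ y ∈ HomRes i (G.X 1) M, ∀ x ∈ HomRes i (Q.X 0) M, (∀ m, y (G.d 1 m) = 0) →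
      (∀ m, x (Q.d 0 m) = y (φ 1 m)) →
      ∃ z ∈ HomRes i (G.X 0) M, (∀ m, y m = z (G.d 0 m)) ∧ ∀ m, x m = z (φ 0 m)) ∧
    (∀ b, ∀ y ∈ HomRes i (G.X (b + 2)) M, ∀ x ∈ HomRes i (Q.X (b + 1)) M,
      (∀ m, y (G.d (b + 2) m) = 0) → (∀ m, x (Q.d (b + 1) m) = y (φ (b + 2) m)) →
      ∃ z ∈ HomRes i (G.X (b + 1)) M, ∃ w ∈ HomRes i (Q.X b) M,
        (∀ m, y m = z (G.d (b + 1) m)) ∧ ∀ m, x m = z (φ (b + 1) m) + w (Q.d b m)) := by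
  let : ∀ b, LieRingModule n (Q.X b) := fun b => LieRingModule.compLieHom (Q.X b) i
  let : ∀ b, LieModule k n (Q.X b) := fun b => LieModule.compLieHom (Q.X b) i
  let : LieRingModule n M := LieRingModule.compLieHom M i
  have hiQ : ∀ b (s : n) (x : Q.X b), ⁅i s, x⁆ = ⁅s, x⁆ := fun b s x => rfl
  have hiM : ∀ (s : n) (x : M), ⁅i s, x⁆ = ⁅s, x⁆ := fun s x => rfl
  let K : ℕ → Type _ := fun b => G.X (b + 1) × Q.X b
  let dG : ∀ b, G.X (b + 1) →ₗ⁅k, n⁆ G.X b := fun b => restrictHom i (hiG _) (hiG _) (G.d b)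
  let dQ : ∀ b, Q.X (b + 1) →ₗ⁅k, n⁆ Q.X b := fun b => restrictHom i (hiQ _) (hiQ _) (Q.d b)
  let φn : ∀ b, Q.X b →ₗ⁅k, n⁆ G.X b := fun b => restrictHom i (hiQ _) (hiG _) (φ b)
  let e : K 0 →ₗ⁅k, n⁆ G.X 0 :=
    { (dG 0 : G.X 1 →ₗ[k] G.X 0).coprod (φn 0 : Q.X 0 →ₗ[k] G.X 0) with
      map_lie' := fun {s m} => by
        change dG 0 ⁅s, m.1⁆ + φn 0 ⁅s, m.2⁆ = ⁅s, dG 0 m.1 + φn 0 m.2⁆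
        simp }
  have he : ∀ m, e m = G.d 0 m.1 + φ 0 m.2 := fun m => rfl
  let d : ∀ b, K (b + 1) →ₗ⁅k, n⁆ K b := fun b =>
    { ((dG (b + 1) : G.X (b + 2) →ₗ[k] G.X (b + 1)).coprod
        (φn (b + 1) : Q.X (b + 1) →ₗ[k] G.X (b + 1))).prod
        (-((dQ b : Q.X (b + 1) →ₗ[k] Q.X b) ∘ₗ LinearMap.snd k _ _)) with
      map_lie' := fun {s m} => by
        change (dG (b + 1) ⁅s, m.1⁆ + φn (b + 1) ⁅s, m.2⁆, -dQ b ⁅s, m.2⁆) =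
          (⁅s, dG (b + 1) m.1 + φn (b + 1) m.2⁆, ⁅s, -dQ b m.2⁆)
        simp }
  have hd : ∀ b m, d b m = (G.d (b + 1) m.1 + φ (b + 1) m.2, -Q.d b m.2) := fun b m => rfl
  have he_surj : Function.Surjective e := fun m => by
    obtain ⟨q, hq⟩ := Q.ε_surjective (G.ε m)
    obtain ⟨f, hf⟩ := (G.exact_zero (m - φ 0 q)).mp (by rw [map_sub, hφ₀, hq, sub_self])
    exact ⟨(f, q), by rw [he, hf, sub_add_cancel]⟩
  have hde : Function.Exact (d 0) e := by
    rintro ⟨f, q⟩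
    constructor
    · intro hm
      have hm : G.d 0 f + φ 0 q = 0 := hm
      obtain ⟨q', hq'⟩ := (Q.exact_zero (-q)).mp (by
        have := congrArg G.ε hm
        rw [map_add, G.exact_zero.apply_apply_eq_zero, zero_add, hφ₀, map_zero] at this
        rw [map_neg, this, neg_zero])
      obtain ⟨f', hf'⟩ := (G.exact_succ 0 (f - φ 1 q')).mp (by
        rw [map_sub, hφ, hq', map_neg, sub_neg_eq_add, hm])
      exact ⟨(f', q'), by rw [hd, hf', hq', sub_add_cancel, neg_neg]⟩
    · rintro ⟨m, hm⟩
      rw [← hm, he, hd]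
      simp [hφ, (G.exact_succ 0).apply_apply_eq_zero]
  have hdd : ∀ b, Function.Exact (d (b + 1)) (d b) := by
    rintro b ⟨f, q⟩
    constructor
    · intro hm
      have hm1 : G.d (b + 1) f + φ (b + 1) q = 0 := congrArg Prod.fst hm
      have hm2 : -Q.d b q = 0 := congrArg Prod.snd hm
      obtain ⟨q', hq'⟩ := (Q.exact_succ b (-q)).mp (by rw [map_neg, hm2])
      obtain ⟨f', hf'⟩ := (G.exact_succ (b + 1) (f - φ (b + 2) q')).mp (by
        rw [map_sub, hφ, hq', map_neg, sub_neg_eq_add, hm1])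
      exact ⟨(f', q'), by rw [hd, hf', hq', sub_add_cancel, neg_neg]⟩
    · rintro ⟨m, hm⟩
      rw [← hm, hd, hd]
      simp [hφ, (G.exact_succ (b + 1)).apply_apply_eq_zero,
        (Q.exact_succ b).apply_apply_eq_zero]
      rfl
  have hQ : ∀ b, LieProjective k n (Q.X b) := fun b =>
    LieProjective.restrict i (hiG 0) (hiQ b) (Q.free b).lieProjective (hG 0).lieProjective
      G.ε G.ε_lie G.ε_surjective
  obtain ⟨ex₀, ex⟩ := hom_exact_of_exact (M := M) (hG 0).lieProjective
    (fun b => (hG (b + 1)).lieProjective.prod (hQ b)) e d he_surj hde hdd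
  let pair : ∀ b (y : G.X (b + 1) →ₗ[k] M) (x : Q.X b →ₗ[k] M), y ∈ HomRes i _ M →
      x ∈ HomRes i _ M → (K b →ₗ⁅k, n⁆ M) := fun b y x hy hx =>
    { y.coprod x with
      map_lie' := fun {s m} => by
        change y ⁅s, m.1⁆ + x ⁅s, m.2⁆ = ⁅s, y m.1 + x m.2⁆
        rw [← hiG, hy, ← hiQ, hx, lie_add]
        rfl }
  have hpair : ∀ b y x hy hx m, pair b y x hy hx m = y m.1 + x m.2 := fun _ _ _ _ _ _ => rfl
  refine ⟨fun y _ h1 h2 => ?_, fun y hy x hx h1 h2 => ?_, fun b y hy x hx h1 h2 => ?_⟩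
  · ext m
    obtain ⟨m, rfl⟩ := he_surj m
    rw [he, map_add, h1, h2, add_zero, LinearMap.zero_apply]
  · obtain ⟨z, hz⟩ := ex₀ (pair 0 y x hy hx) fun m => by
      simp [hpair, hd, h1, h2]
    refine ⟨z, mem_homRes_of_lie i (hiG 0) hiM z, fun m => ?_, fun m => ?_⟩
    · have := hz (m, 0)
      simpa [hpair, he] using this
    · have := hz (0, m)
      simpa [hpair, he] using this
  · obtain ⟨zw, hzw⟩ := ex b (pair (b + 1) y x hy hx) fun m => by
      simp [hpair, hd, h1, h2]
    let inl : G.X (b + 1) →ₗ⁅k, n⁆ K b := lieInl k n _ _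
    let inr : Q.X b →ₗ⁅k, n⁆ K b := lieInr k n _ _
    refine ⟨zw.comp inl, mem_homRes_of_lie i (hiG _) hiM (zw.comp inl),
      -(zw.comp inr), neg_mem (mem_homRes_of_lie i (hiQ _) hiM (zw.comp inr)),
      fun m => ?_, fun m => ?_⟩
    · have := hzw (m, 0)
      change y m = zw (G.d (b + 1) m, 0)
      simpa [hpair, hd] using this
    · have := hzw (0, m)
      change x m = zw (φ (b + 1) m, 0) + -zw (0, Q.d b m)
      rw [← map_neg, ← map_add]
      simpa [hpair, hd] using this

end Cone

/-! ### The columns of the double complex -/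

section Columns

variable {k : Type*} [Field k]
  {n : Type*} [LieRing n] [LieAlgebra k n]
  {g : Type*} [LieRing g] [LieAlgebra k g]
  {h : Type*} [LieRing h] [LieAlgebra k h]
  (i : n →ₗ⁅k⁆ g) (π : g →ₗ⁅k⁆ h)

theorem homHN_congr {Y X M : Type*}
    [AddCommGroup Y] [Module k Y] [LieRingModule h Y] [LieModule k h Y]
    [AddCommGroup X] [Module k X] [LieRingModule g X] [LieModule k g X]
    [AddCommGroup M] [Module k M] [LieRingModule g M] [LieModule k g M]
    {f f' : HomHN i π Y X M} (e : f = f') (y : Y) (m : X) :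
    (f : Y →ₗ[k] X →ₗ[k] M) y m = (f' : Y →ₗ[k] X →ₗ[k] M) y m := by
  rw [e]

variable [LieAlgebra.IsExtension i π]

include π in
theorem IsExtension.injective : Function.Injective i :=
  (LieHom.ker_eq_bot i).mp (LieAlgebra.IsExtension.ker_eq_bot π)

/-- Every element of `g` is the sum of an element of `n` and an element of `σ(h)`. -/
theorem IsExtension.exists_add (σ : h →ₗ⁅k⁆ g) (hσ : ∀ α, π (σ α) = α) (x : g) :
    ∃ s, x = i s + σ (π x) := by
  have hex : Function.Exact i π :=
    (LieHom.range_eq_ker_iff i π).mp (LieAlgebra.IsExtension.exact (i := i) (p := π))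
  obtain ⟨s, hs⟩ := (hex (x - σ (π x))).mp (by rw [map_sub, hσ, sub_self])
  exact ⟨s, by rw [hs, sub_add_cancel]⟩

section Action

variable (σ : h →ₗ⁅k⁆ g) (X M : Type*)
  [AddCommGroup X] [Module k X] [LieRingModule g X] [LieModule k g X]
  [AddCommGroup M] [Module k M] [LieRingModule g M] [LieModule k g M]

/-- The action of `h` on `Hom_n(X, M)`, through the section `σ`. -/
@[reducible] def homResLieRingModule : LieRingModule h (HomRes i X M) where
  bracket α f := ⟨⁅σ α, (f : X →ₗ[k] M)⁆, lie_mem_homRes i π (σ α) (f : X →ₗ[k] M) f.2⟩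
  add_lie α β f := by
    ext1
    change ⁅σ (α + β), (f : X →ₗ[k] M)⁆ = ⁅σ α, (f : X →ₗ[k] M)⁆ + ⁅σ β, (f : X →ₗ[k] M)⁆
    rw [map_add, add_lie]
  lie_add α f f' := by
    ext1
    exact lie_add (σ α) (f : X →ₗ[k] M) (f' : X →ₗ[k] M)
  leibniz_lie α β f := by
    ext1
    change ⁅σ α, ⁅σ β, (f : X →ₗ[k] M)⁆⁆ =
      ⁅σ ⁅α, β⁆, (f : X →ₗ[k] M)⁆ + ⁅σ β, ⁅σ α, (f : X →ₗ[k] M)⁆⁆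
    rw [LieHom.map_lie, leibniz_lie]

theorem homResLieModule :
    letI := homResLieRingModule i π σ X M
    LieModule k h (HomRes i X M) :=
  letI := homResLieRingModule i π σ X M
  { smul_lie := fun c α f => by
      ext1
      change ⁅σ (c • α), (f : X →ₗ[k] M)⁆ = c • ⁅σ α, (f : X →ₗ[k] M)⁆
      rw [map_smul, smul_lie]
    lie_smul := fun c α f => by
      ext1
      exact lie_smul c (σ α) (f : X →ₗ[k] M) }

/-- The `h`-linear map `Hom_n(X, M) → Hom_n(X', M)` induced by a map `X' → X` of `g`-modules. -/
def homResMap {X X' : Type*}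
    [AddCommGroup X] [Module k X] [LieRingModule g X] [LieModule k g X]
    [AddCommGroup X'] [Module k X'] [LieRingModule g X'] [LieModule k g X']
    (ψ : X' →ₗ⁅k, g⁆ X) :
    letI := homResLieRingModule i π σ X M
    letI := homResLieRingModule i π σ X' M
    HomRes i X M →ₗ⁅k, h⁆ HomRes i X' M :=
  letI := homResLieRingModule i π σ X M
  letI := homResLieRingModule i π σ X' M
  { (LinearMap.lcomp k M (ψ : X' →ₗ[k] X)).restrict (p := HomRes i X M)
      (q := HomRes i X' M) fun f hf s m => by
      have hf' : ∀ (s : n) (m : X), f ⁅i s, m⁆ = ⁅i s, f m⁆ := hf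
      change f (ψ ⁅i s, m⁆) = ⁅i s, f (ψ m)⁆
      rw [LieModuleHom.map_lie, hf'] with
    map_lie' := fun {α f} => by
      ext m
      change ⁅σ α, (f : X →ₗ[k] M) (ψ m)⁆ - (f : X →ₗ[k] M) ⁅σ α, ψ m⁆ =
        ⁅σ α, (f : X →ₗ[k] M) (ψ m)⁆ - (f : X →ₗ[k] M) (ψ ⁅σ α, m⁆)
      rw [LieModuleHom.map_lie] }

end Action

section Maps

variable (σ : h →ₗ⁅k⁆ g) (Y X M : Type*)
  [AddCommGroup Y] [Module k Y] [LieRingModule h Y] [LieModule k h Y]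
  [AddCommGroup X] [Module k X] [LieRingModule g X] [LieModule k g X]
  [AddCommGroup M] [Module k M] [LieRingModule g M] [LieModule k g M]

/-- An element of `HomHN`, as an `h`-linear map into `Hom_n(X, M)`. -/
def homHNToLie (hσ : ∀ α, π (σ α) = α) (f : HomHN i π Y X M) :
    letI := homResLieRingModule i π σ X M
    Y →ₗ⁅k, h⁆ HomRes i X M :=
  letI := homResLieRingModule i π σ X M
  { (f : Y →ₗ[k] X →ₗ[k] M).codRestrict (HomRes i X M) f.2.1 with
    map_lie' := fun {α y} => by
      ext1
      have := f.2.2 (σ α) y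
      rwa [hσ] at this }

/-- An `h`-linear map into `Hom_n(X, M)`, as an element of `HomHN`. -/
def lieToHomHN (hσ : ∀ α, π (σ α) = α)
    (f : letI := homResLieRingModule i π σ X M; Y →ₗ⁅k, h⁆ HomRes i X M) : HomHN i π Y X M :=
  letI := homResLieRingModule i π σ X M
  ⟨(HomRes i X M).subtype ∘ₗ (f : Y →ₗ[k] HomRes i X M), fun y => (f y).2, fun x y => by
    obtain ⟨s, hs⟩ := IsExtension.exists_add i π σ hσ x
    have h1 : (f ⁅π x, y⁆ : X →ₗ[k] M) = ⁅σ (π x), (f y : X →ₗ[k] M)⁆ :=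
      congrArg Subtype.val (f.map_lie (π x) y)
    change (f ⁅π x, y⁆ : X →ₗ[k] M) = ⁅x, (f y : X →ₗ[k] M)⁆
    conv_rhs => rw [hs]
    rw [h1, add_lie, lie_homRes_eq_zero i s _ (f y).2, zero_add]⟩

end Maps

section Exact

variable (σ : h →ₗ⁅k⁆ g) (hσ : ∀ α, π (σ α) = α) (P : Type*)
  [AddCommGroup P] [Module k P] [LieRingModule h P] [LieModule k h P]
  (Q : FreeResolution k g) (G : LieResolution k g)
  [∀ b, LieRingModule n (G.X b)] [∀ b, LieModule k n (G.X b)]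
  (M : Type*) [AddCommGroup M] [Module k M] [LieRingModule g M] [LieModule k g M]

include hσ in
/-- For a free `h`-module `P`, the exactness of `homRes_cone_exact` persists after applying
`Hom_h(P, -)`. -/
theorem homHN_cone_exact (hP : IsFreeLieModule k h P)
    (hiG : ∀ b (s : n) (x : G.X b), ⁅i s, x⁆ = ⁅s, x⁆)
    (hG : ∀ b, IsFreeLieModule k n (G.X b))
    (φ : ∀ b, Q.X b →ₗ⁅k, g⁆ G.X b) (hφ₀ : ∀ x, G.ε (φ 0 x) = Q.ε x)
    (hφ : ∀ b x, G.d b (φ (b + 1) x) = φ b (Q.d b x)) :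
    (∀ y : HomHN i π P (G.X 0) M, homHNMap i π M LieModuleHom.id (G.d 0) y = 0 →
      homHNMap i π M LieModuleHom.id (φ 0) y = 0 → y = 0) ∧
    (∀ (y : HomHN i π P (G.X 1) M) (x : HomHN i π P (Q.X 0) M),
      homHNMap i π M LieModuleHom.id (G.d 1) y = 0 →
      homHNMap i π M LieModuleHom.id (Q.d 0) x = homHNMap i π M LieModuleHom.id (φ 1) y →
      ∃ z : HomHN i π P (G.X 0) M, y = homHNMap i π M LieModuleHom.id (G.d 0) z ∧
        x = homHNMap i π M LieModuleHom.id (φ 0) z) ∧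
    (∀ b (y : HomHN i π P (G.X (b + 2)) M) (x : HomHN i π P (Q.X (b + 1)) M),
      homHNMap i π M LieModuleHom.id (G.d (b + 2)) y = 0 →
      homHNMap i π M LieModuleHom.id (Q.d (b + 1)) x =
        homHNMap i π M LieModuleHom.id (φ (b + 2)) y →
      ∃ (z : HomHN i π P (G.X (b + 1)) M) (w : HomHN i π P (Q.X b) M),
        y = homHNMap i π M LieModuleHom.id (G.d (b + 1)) z ∧
        x = homHNMap i π M LieModuleHom.id (φ (b + 1)) z +
          homHNMap i π M LieModuleHom.id (Q.d b) w) := by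
  obtain ⟨c0, c1, c2⟩ := homRes_cone_exact i Q G M hiG hG φ hφ₀ hφ
  refine ⟨fun y h1 h2 => ?_, fun y x h1 h2 => ?_, fun b y x h1 h2 => ?_⟩
  · ext p : 2
    exact c0 _ (y.2.1 p) (homHN_congr i π h1 p) (homHN_congr i π h2 p)
  · let _ := homResLieRingModule i π σ (G.X 0) M
    let _ := homResLieRingModule i π σ (G.X 1) M
    let _ := homResLieRingModule i π σ (Q.X 0) M
    have _ := homResLieModule i π σ (G.X 0) M
    have _ := homResLieModule i π σ (G.X 1) M
    have _ := homResLieModule i π σ (Q.X 0) M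
    obtain ⟨t, ht⟩ := hP.lieProjective _ _
      (lieProd (homResMap i π σ M (G.d 0)) (homResMap i π σ M (φ 0)))
      (lieProd (homHNToLie i π σ P _ M hσ y) (homHNToLie i π σ P _ M hσ x)) fun p => by
        obtain ⟨z, hz, hz1, hz2⟩ := c1 _ (y.2.1 p) _ (x.2.1 p) (homHN_congr i π h1 p)
          (homHN_congr i π h2 p)
        refine ⟨⟨z, hz⟩, Prod.ext ?_ ?_⟩ <;> ext m
        exacts [(hz1 m).symm, (hz2 m).symm]
    refine ⟨lieToHomHN i π σ P _ M hσ t, ?_, ?_⟩ <;> ext p m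
    · exact (LinearMap.congr_fun (congrArg (fun u => (u.1 : _ →ₗ[k] M)) (ht p)) m).symm
    · exact (LinearMap.congr_fun (congrArg (fun u => (u.2 : _ →ₗ[k] M)) (ht p)) m).symm
  · let _ := homResLieRingModule i π σ (G.X (b + 1)) M
    let _ := homResLieRingModule i π σ (G.X (b + 2)) M
    let _ := homResLieRingModule i π σ (Q.X b) M
    let _ := homResLieRingModule i π σ (Q.X (b + 1)) M
    have _ := homResLieModule i π σ (G.X (b + 1)) M
    have _ := homResLieModule i π σ (G.X (b + 2)) M
    have _ := homResLieModule i π σ (Q.X b) M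
    have _ := homResLieModule i π σ (Q.X (b + 1)) M
    obtain ⟨t, ht⟩ := hP.lieProjective _ _
      (lieProd ((homResMap i π σ M (G.d (b + 1))).comp (lieFst k h _ _))
        ((homResMap i π σ M (φ (b + 1))).comp (lieFst k h _ _) +
          (homResMap i π σ M (Q.d b)).comp (lieSnd k h _ _)))
      (lieProd (homHNToLie i π σ P _ M hσ y) (homHNToLie i π σ P _ M hσ x)) fun p => by
        obtain ⟨z, hz, w, hw, hz1, hz2⟩ := c2 b _ (y.2.1 p) _ (x.2.1 p) (homHN_congr i π h1 p)
          (homHN_congr i π h2 p)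
        refine ⟨(⟨z, hz⟩, ⟨w, hw⟩), Prod.ext ?_ ?_⟩ <;> ext m
        exacts [(hz1 m).symm, (hz2 m).symm]
    refine ⟨lieToHomHN i π σ P _ M hσ ((lieFst k h _ _).comp t),
      lieToHomHN i π σ P _ M hσ ((lieSnd k h _ _).comp t), ?_, ?_⟩ <;> ext p m
    · exact (LinearMap.congr_fun (congrArg (fun u => (u.1 : _ →ₗ[k] M)) (ht p)) m).symm
    · exact (LinearMap.congr_fun (congrArg (fun u => (u.2 : _ →ₗ[k] M)) (ht p)) m).symm

include hσ in
/-- The statement of `homHN_cone_exact` for vertical differentials with a sign `c`. -/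
theorem homHN_cone_exact_smul (hP : IsFreeLieModule k h P)
    (hiG : ∀ b (s : n) (x : G.X b), ⁅i s, x⁆ = ⁅s, x⁆)
    (hG : ∀ b, IsFreeLieModule k n (G.X b))
    (φ : ∀ b, Q.X b →ₗ⁅k, g⁆ G.X b) (hφ₀ : ∀ x, G.ε (φ 0 x) = Q.ε x)
    (hφ : ∀ b x, G.d b (φ (b + 1) x) = φ b (Q.d b x)) {c : k} (hc : c * c = 1) :
    (∀ y : HomHN i π P (G.X 0) M, c • homHNMap i π M LieModuleHom.id (G.d 0) y = 0 →
      homHNMap i π M LieModuleHom.id (φ 0) y = 0 → y = 0) ∧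
    (∀ (y : HomHN i π P (G.X 1) M) (x : HomHN i π P (Q.X 0) M),
      c • homHNMap i π M LieModuleHom.id (G.d 1) y = 0 →
      c • homHNMap i π M LieModuleHom.id (Q.d 0) x = homHNMap i π M LieModuleHom.id (φ 1) y →
      ∃ z : HomHN i π P (G.X 0) M, y = c • homHNMap i π M LieModuleHom.id (G.d 0) z ∧
        x = homHNMap i π M LieModuleHom.id (φ 0) z) ∧
    (∀ b (y : HomHN i π P (G.X (b + 2)) M) (x : HomHN i π P (Q.X (b + 1)) M),
      c • homHNMap i π M LieModuleHom.id (G.d (b + 2)) y = 0 →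
      c • homHNMap i π M LieModuleHom.id (Q.d (b + 1)) x =
        homHNMap i π M LieModuleHom.id (φ (b + 2)) y →
      ∃ (z : HomHN i π P (G.X (b + 1)) M) (w : HomHN i π P (Q.X b) M),
        y = c • homHNMap i π M LieModuleHom.id (G.d (b + 1)) z ∧
        x = homHNMap i π M LieModuleHom.id (φ (b + 1)) z +
          c • homHNMap i π M LieModuleHom.id (Q.d b) w) := by
  have hc0 : c ≠ 0 := left_ne_zero_of_mul_eq_one hc
  obtain ⟨c0, c1, c2⟩ := homHN_cone_exact i π σ hσ P Q G M hP hiG hG φ hφ₀ hφ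
  -- The sign is absorbed in `y` and in `w`.
  refine ⟨fun y h1 h2 => ?_, fun y x h1 h2 => ?_, fun b y x h1 h2 => ?_⟩
  · exact c0 y ((smul_eq_zero_iff_right hc0).mp h1) h2
  · obtain ⟨z, h3, h4⟩ := c1 (c • y) x (by rw [map_smul, h1])
      (by rw [map_smul, ← h2, smul_smul, hc, one_smul])
    exact ⟨z, by rw [← h3, smul_smul, hc, one_smul], h4⟩
  · obtain ⟨z, w, h3, h4⟩ := c2 b (c • y) x (by rw [map_smul, h1])
      (by rw [map_smul, ← h2, smul_smul, hc, one_smul])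
    refine ⟨z, c • w, by rw [← h3, smul_smul, hc, one_smul], ?_⟩
    rw [map_smul, smul_smul, hc, one_smul, h4]

end Exact
end Columns

/-! ### Filtered complexes with quasi-isomorphic quotients -/

namespace FilteredComplex

variable {k : Type*} [Field k] {A B : FilteredComplex k} (φ : A.T →ₗ[k] B.T)

theorem Fil_le (K : FilteredComplex k) (p n : ℤ) (r : ℕ) : K.Fil (p + r) n ≤ K.Fil p n := by
  induction r with
  | zero => simp
  | succ r ih =>
    refine le_trans ?_ ih
    have := K.Fil_anti (p + r) n
    rwa [add_assoc] at this

theorem Fil_le_of_le (K : FilteredComplex k) {p p' : ℤ} (n : ℤ) (hp : p ≤ p') :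
    K.Fil p' n ≤ K.Fil p n := by
  have := K.Fil_le p n (p' - p).toNat
  rwa [Int.toNat_of_nonneg (by omega), add_sub_cancel] at this

/-- The mapping cone of the map induced by `φ` on `F^p / F^{p+r}` is exact. The pair `(x, y)` is a
cocycle of the cone modulo `F^{p+r}`, and `(w, z)` bounds it there. -/
def ConeExact (r : ℕ) : Prop :=
  ∀ p n : ℤ, ∀ x ∈ B.Fil p n, ∀ y ∈ A.Fil p (n + 1),
    A.D y ∈ A.Fil (p + r) (n + 2) → B.D x - φ y ∈ B.Fil (p + r) (n + 1) →
    ∃ z ∈ A.Fil p n, ∃ w ∈ B.Fil p (n - 1),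
      y - A.D z ∈ A.Fil (p + r) (n + 1) ∧ x - φ z - B.D w ∈ B.Fil (p + r) n

variable {φ}

/-- If `φ` is a quasi-isomorphism on all `F^p / F^{p+1}`, then it is one on all `F^p / F^{p+r}`. -/
theorem ConeExact.of_one (hφD : ∀ y, φ (A.D y) = B.D (φ y))
    (h1 : ConeExact φ 1) (r : ℕ) :
    ConeExact φ r := by
  induction r with
  | zero =>
    intro p n x hx y hy _ _
    refine ⟨0, zero_mem _, 0, zero_mem _, ?_, ?_⟩
    · simpa using hy
    · simpa using hx
  | succ r ih =>
    intro p n x hx y hy hDy hDx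
    have hp : p + ((r + 1 : ℕ) : ℤ) = p + 1 + (r : ℤ) := by push_cast; ring
    rw [hp] at hDy hDx ⊢
    obtain ⟨z, hz, w, hw, h2, h3⟩ := h1 p n x hx y hy
      (by simpa using A.Fil_le _ _ r hDy) (by simpa using B.Fil_le _ _ r hDx)
    rw [Nat.cast_one] at h2 h3
    obtain ⟨z', hz', w', hw', h4, h5⟩ := ih (p + 1) n _ h3 _ h2
      (by rwa [map_sub, A.D_D, sub_zero]) (by
        have : B.D (x - φ z - B.D w) - φ (y - A.D z) = B.D x - φ y := by
          simp only [map_sub, B.D_D, hφD]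
          abel
        rwa [this])
    refine ⟨z + z', add_mem hz (A.Fil_anti _ _ hz'), w + w', add_mem hw (B.Fil_anti _ _ hw'),
      ?_, ?_⟩
    · rwa [map_add, ← sub_sub]
    · have : x - φ (z + z') - B.D (w + w') = x - φ z - B.D w - φ z' - B.D w' := by
        simp only [map_add]
        abel
      rwa [this]

/-- The differential `d_r^{p,q}` vanishes if every element of `Z_r^{p,q}` can be moved into
`F^{p+1}` by subtracting a cocycle. -/
theorem d_eq_zero_of_exists (K : FilteredComplex k) (r p q : ℤ)
    (h : ∀ x ∈ K.Z r p q, ∃ x' ∈ K.Fil (p + 1) (p + q), K.D x' = K.D x) : K.d r p q = 0 := by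
  apply Submodule.linearMap_qext
  ext ⟨x, hx⟩
  obtain ⟨x', hx', hD⟩ := h x hx
  refine (Submodule.Quotient.mk_eq_zero (K.denom r (p + r) (q - r + 1))).mpr ?_
  refine Submodule.mem_comap.mpr (Submodule.mem_sup_right ⟨(K.D_mem_Z r p q x hx).1, x', ?_, hD⟩)
  rwa [show p + r - (r - 1) = p + 1 by ring, show p + r + (q - r + 1) - 1 = p + q by ring]

/-- The criterion `d_eq_zero_of_exists` passes along a quasi-isomorphism on `F^p / F^{p+r}`: such a
map is surjective on `E_r`. -/
theorem ConeExact.exists_of_exists (hφD : ∀ y, φ (A.D y) = B.D (φ y))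
    (hφF : ∀ p n, ∀ y ∈ A.Fil p n, φ y ∈ B.Fil p n) {r : ℕ} (hr : 1 ≤ r) (h : ConeExact φ r)
    {p q : ℤ} (hA : ∀ y ∈ A.Z r p q, ∃ y' ∈ A.Fil (p + 1) (p + q), A.D y' = A.D y)
    (x : B.T) (hx : x ∈ B.Z r p q) : ∃ x' ∈ B.Fil (p + 1) (p + q), B.D x' = B.D x := by
  obtain ⟨y, hy, w, -, h2, h3⟩ := h p (p + q) x hx.1 0 (zero_mem _)
    (by rw [map_zero]; exact zero_mem _) (by
      rw [map_zero, sub_zero]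
      exact hx.2)
  rw [zero_sub, neg_mem_iff] at h2
  obtain ⟨y', hy', hD⟩ := hA y ⟨hy, h2⟩
  refine ⟨φ y' + (x - φ y - B.D w),
    add_mem (hφF _ _ _ hy') (B.Fil_le_of_le _ (by omega) h3), ?_⟩
  simp only [map_add, map_sub, B.D_D, ← hφD, hD]
  abel

end FilteredComplex

/-! ### Maps of double complexes -/

namespace DoubleComplex

open FilteredComplex

section Truncation

variable {k : Type*} [Field k] (A : DoubleComplex k)

/-- The part of a family in the rows `b ≥ q`. -/
def rowTruncation (q : ℕ) (x : A.total.T) : A.total.T :=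
  fun a b => if q ≤ b then x a b else 0

theorem rowTruncation_apply (q : ℕ) (x : A.total.T) (a b : ℕ) :
    A.rowTruncation q x a b = if q ≤ b then x a b else 0 := rfl

/-- If the vertical differential from row `q - 1` to row `q` is zero, then the truncation to the
rows `b ≥ q` is a chain map. -/
theorem totalD_rowTruncation (q : ℕ) (hq : ∀ b, b + 1 = q → ∀ a, A.dv a b = 0)
    (x : A.total.T) :
    A.total.D (A.rowTruncation q x) = A.rowTruncation q (A.total.D x) := by
  have hh : ∀ a b, A.hPart (A.rowTruncation q x) a b = if q ≤ b then A.hPart x a b else 0 := by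
    rintro (_ | a) b <;> by_cases hb : q ≤ b <;> simp [hPart, rowTruncation, hb]
  have hv : ∀ a b, A.vPart (A.rowTruncation q x) a b = if q ≤ b then A.vPart x a b else 0 := by
    rintro a (_ | b)
    · simp [vPart]
    · rcases lt_trichotomy (b + 1) q with hb | hb | hb
      · simp [vPart, rowTruncation, show ¬ q ≤ b by omega, show ¬ q ≤ b + 1 by omega]
      · simp [vPart, hq b hb a]
      · simp [vPart, rowTruncation, show q ≤ b by omega, show q ≤ b + 1 by omega]
  funext a b
  change A.hPart _ a b + A.vPart _ a b = if q ≤ b then A.hPart x a b + A.vPart x a b else 0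
  rw [hh, hv]
  split_ifs <;> simp

/-- If the vertical differential from row `q - 1` to row `q` is zero, then for `q ≤ s ≤ q + r - 2`
the elements of `Z_r^{p,s}` differ from elements of `F^{p+1}` by cocycles. -/
theorem exists_mem_columnFil_of_dv_eq_zero (q : ℕ) (hq : ∀ b, b + 1 = q → ∀ a, A.dv a b = 0)
    (r p s : ℤ) (hs : q ≤ s) (hs' : s ≤ q + r - 2) (x : A.total.T) (hx : x ∈ A.total.Z r p s) :
    ∃ x' ∈ A.total.Fil (p + 1) (p + s), A.total.D x' = A.total.D x := by
  have hx1 : ∀ a b : ℕ, ¬ ((a : ℤ) + b = p + s ∧ p ≤ a) → x a b = 0 := hx.1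
  have hx2 : ∀ a b : ℕ, ¬ ((a : ℤ) + b = p + s + 1 ∧ p + r ≤ a) → A.total.D x a b = 0 := hx.2
  have hD : A.total.D (A.rowTruncation q x) = 0 := by
    rw [A.totalD_rowTruncation q hq]
    funext a b
    rw [rowTruncation_apply]
    split_ifs with hb
    · exact hx2 a b (by omega)
    · rfl
  refine ⟨x - A.rowTruncation q x, fun a b hab => ?_, ?_⟩
  · change x a b - A.rowTruncation q x a b = 0
    rw [rowTruncation_apply]
    split_ifs with hb
    · exact sub_self _
    · rw [sub_zero]
      exact hx1 a b (by omega)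
  · rw [map_sub, hD, sub_zero]

end Truncation

section Map

variable {k : Type*} [Field k] {A B : DoubleComplex k}
  (φ : ∀ a b, A.C a b →ₗ[k] B.C a b)

/-- The map of total complexes induced by a family of maps `A^{a,b} → B^{a,b}`. -/
def totalMap : A.total.T →ₗ[k] B.total.T where
  toFun x a b := φ a b (x a b)
  map_add' x y := by
    funext a b
    exact map_add (φ a b) _ _
  map_smul' c x := by
    funext a b
    exact map_smul (φ a b) _ _

theorem totalMap_apply (x : A.total.T) (a b : ℕ) : totalMap φ x a b = φ a b (x a b) := rfl

variable {φ}

theorem totalMap_D (hh : ∀ a b x, φ (a + 1) b (A.dh a b x) = B.dh a b (φ a b x))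
    (hv : ∀ a b x, φ a (b + 1) (A.dv a b x) = B.dv a b (φ a b x)) (x : A.total.T) :
    totalMap φ (A.total.D x) = B.total.D (totalMap φ x) := by
  funext a b
  change φ a b (A.hPart x a b + A.vPart x a b) =
    B.hPart (totalMap φ x) a b + B.vPart (totalMap φ x) a b
  rcases a with _ | a <;> rcases b with _ | b <;> simp [hPart, vPart, hh, hv, totalMap_apply]

theorem totalMap_mem_Fil (p n : ℤ) (x : A.total.T) (hx : x ∈ A.total.Fil p n) :
    totalMap φ x ∈ B.total.Fil p n := fun a b hab => by
  rw [totalMap_apply, show x a b = 0 from hx a b hab, map_zero]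

/-- On the first nonzero column of an element of `F^a`, the total differential is `d_v`. -/
theorem total_D_apply_succ (K : DoubleComplex k) {n : ℤ} {a : ℕ} {x : K.total.T}
    (hx : x ∈ K.total.Fil a n) (b : ℕ) : K.total.D x a (b + 1) = K.dv a b (x a b) := by
  change K.hPart x a (b + 1) + K.dv a b (x a b) = _
  rcases a with _ | a
  · simp [hPart]
  · have h0 : x a (b + 1) = 0 := hx a (b + 1) (by push_cast; omega)
    simp [hPart, h0]

theorem total_D_apply_zero (K : DoubleComplex k) {n : ℤ} {a : ℕ} {x : K.total.T}
    (hx : x ∈ K.total.Fil a n) : K.total.D x a 0 = 0 := by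
  change K.hPart x a 0 + 0 = _
  rcases a with _ | a
  · simp [hPart]
  · have h0 : x a 0 = 0 := hx a 0 (by push_cast; omega)
    simp [hPart, h0]

/-- The family with a single entry. -/
def single (K : DoubleComplex k) (a b : ℕ) (x : K.C a b) : K.total.T :=
  Pi.single a (Pi.single b x)

theorem single_apply_self (K : DoubleComplex k) (a b : ℕ) (x : K.C a b) :
    K.single a b x a b = x := by
  simp [single]

theorem single_mem_Fil (K : DoubleComplex k) (a b : ℕ) (x : K.C a b) :
    K.single a b x ∈ K.total.Fil a (a + b) := fun a' b' hab => by
  by_cases ha : a' = a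
  · subst ha
    have hb : b' ≠ b := by
      rintro rfl
      exact hab ⟨rfl, le_rfl⟩
    simp [single, hb]
  · simp [single, ha]

theorem mem_Fil_succ (K : DoubleComplex k) {n : ℤ} {a : ℕ} {x : K.total.T}
    (hx : x ∈ K.total.Fil a n) (h : ∀ b : ℕ, (a : ℤ) + b = n → x a b = 0) :
    x ∈ K.total.Fil (a + 1) n := fun a' b' hab => by
  by_cases ha : a' = a
  · subst ha
    by_cases hb : (a' : ℤ) + b' = n
    · exact h b' hb
    · exact hx a' b' (fun h' => hb h'.1)
  · exact hx a' b' (by omega)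

/-- A map of double complexes whose columns have exact mapping cones induces quasi-isomorphisms on
the quotients `F^p / F^{p+1}` of the total complexes. -/
theorem coneExact_one
    (c0 : ∀ a (y : A.C a 0), A.dv a 0 y = 0 → φ a 0 y = 0 → y = 0)
    (c1 : ∀ a (y : A.C a 1) (x : B.C a 0), A.dv a 1 y = 0 → B.dv a 0 x = φ a 1 y →
      ∃ z, y = A.dv a 0 z ∧ x = φ a 0 z)
    (c2 : ∀ a b (y : A.C a (b + 2)) (x : B.C a (b + 1)), A.dv a (b + 2) y = 0 →
      B.dv a (b + 1) x = φ a (b + 2) y →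
      ∃ z w, y = A.dv a (b + 1) z ∧ x = φ a (b + 1) z + B.dv a b w) :
    ConeExact (A := A.total) (B := B.total) (totalMap φ) 1 := by
  intro p n x hx y hy hDy hDx
  rw [Nat.cast_one] at hDy hDx ⊢
  rcases lt_or_ge p 0 with hp | hp
  · -- There are no columns of negative index, so `F^p = F^{p+1}`.
    refine ⟨0, zero_mem _, 0, zero_mem _, ?_, ?_⟩ <;> intro a b hab
    · simpa using hy a b (by omega)
    · simpa using hx a b (by omega)
  lift p to ℕ using hp
  have hDy' : ∀ b : ℕ, A.dv p b (y p b) = 0 := fun b => by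
    rw [← A.total_D_apply_succ hy]
    exact hDy p (b + 1) (by omega)
  have hDx' : ∀ b : ℕ, B.dv p b (x p b) = φ p (b + 1) (y p (b + 1)) := fun b => by
    rw [← B.total_D_apply_succ hx, ← sub_eq_zero]
    exact hDx p (b + 1) (by omega)
  have hDx₀ : φ p 0 (y p 0) = 0 := by
    have h : B.total.D x p 0 - φ p 0 (y p 0) = 0 := hDx p 0 (by omega)
    rwa [B.total_D_apply_zero hx, zero_sub, neg_eq_zero] at h
  rcases lt_trichotomy n (p : ℤ) with hn | rfl | hn
  · refine ⟨0, zero_mem _, 0, zero_mem _, ?_, ?_⟩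
    · rw [map_zero, sub_zero]
      refine A.mem_Fil_succ hy fun b hb => ?_
      obtain rfl : b = 0 := by omega
      exact c0 p _ (hDy' 0) hDx₀
    · rw [map_zero, map_zero, sub_zero, sub_zero]
      exact B.mem_Fil_succ hx fun b hb => by omega
  · obtain ⟨z, h1, h2⟩ := c1 p (y p 1) (x p 0) (hDy' 1) (hDx' 0)
    have hz : A.single p 0 z ∈ A.total.Fil p p := by simpa using A.single_mem_Fil p 0 z
    refine ⟨_, hz, 0, zero_mem _, ?_, ?_⟩
    · refine A.mem_Fil_succ (sub_mem hy (A.total.D_mem _ _ _ hz)) fun b hb => ?_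
      obtain rfl : b = 1 := by omega
      change y p 1 - A.total.D (A.single p 0 z) p 1 = 0
      rw [A.total_D_apply_succ hz, single_apply_self, ← h1, sub_self]
    · rw [map_zero, sub_zero]
      refine B.mem_Fil_succ (sub_mem hx (totalMap_mem_Fil _ _ _ hz)) fun b hb => ?_
      obtain rfl : b = 0 := by omega
      change x p 0 - φ p 0 (A.single p 0 z p 0) = 0
      rw [single_apply_self, ← h2, sub_self]
  · obtain ⟨c, rfl⟩ : ∃ c : ℕ, n = p + (c + 1 : ℕ) :=
      ⟨(n - p - 1).toNat, by push_cast; omega⟩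
    obtain ⟨z, w, h1, h2⟩ := c2 p c (y p (c + 2)) (x p (c + 1)) (hDy' (c + 2)) (hDx' (c + 1))
    have hz := A.single_mem_Fil p (c + 1) z
    have hw : B.single p c w ∈ B.total.Fil p (p + (c + 1 : ℕ) - 1) := by
      have := B.single_mem_Fil p c w
      rwa [show (p : ℤ) + (c + 1 : ℕ) - 1 = p + c by push_cast; ring]
    have hDw : B.total.D (B.single p c w) ∈ B.total.Fil p (p + (c + 1 : ℕ)) := by
      simpa using B.total.D_mem _ _ _ hw
    refine ⟨_, hz, _, hw, ?_, ?_⟩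
    · refine A.mem_Fil_succ (sub_mem hy (A.total.D_mem _ _ _ hz)) fun b hb => ?_
      obtain rfl : b = c + 2 := by omega
      change y p (c + 2) - A.total.D (A.single p (c + 1) z) p (c + 1 + 1) = 0
      rw [A.total_D_apply_succ hz, single_apply_self, ← h1, sub_self]
    · refine B.mem_Fil_succ (sub_mem (sub_mem hx (totalMap_mem_Fil _ _ _ hz)) hDw) fun b hb => ?_
      obtain rfl : b = c + 1 := by omega
      change x p (c + 1) - φ p (c + 1) (A.single p (c + 1) z p (c + 1)) -
        B.total.D (B.single p c w) p (c + 1) = 0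
      rw [B.total_D_apply_succ hw, single_apply_self, single_apply_self, h2, add_sub_cancel_left,
        sub_self]

end Map

end DoubleComplex

/-! ### The action of `g` on a resolution with a compatible action -/

section CompatibleAction

variable {k : Type*} [Field k]
  {n : Type*} [LieRing n] [LieAlgebra k n]
  {g : Type*} [LieRing g] [LieAlgebra k g]
  {h : Type*} [LieRing h] [LieAlgebra k h]
  (i : n →ₗ⁅k⁆ g) (π : g →ₗ⁅k⁆ h) [LieAlgebra.IsExtension i π]
  (σ : h →ₗ⁅k⁆ g) (hσ : ∀ α, π (σ α) = α)

/-- The `n`-component of an element of `g`, for the decomposition `g = n ⊕ σ(h)`. -/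
noncomputable def nPart (x : g) : n := (IsExtension.exists_add i π σ hσ x).choose

theorem nPart_spec (x : g) : i (nPart i π σ hσ x) = x - σ (π x) :=
  eq_sub_of_add_eq (IsExtension.exists_add i π σ hσ x).choose_spec.symm

theorem nPart_add (x y : g) :
    nPart i π σ hσ (x + y) = nPart i π σ hσ x + nPart i π σ hσ y := by
  apply IsExtension.injective i π
  simp only [map_add, nPart_spec]
  abel

theorem nPart_smul (c : k) (x : g) : nPart i π σ hσ (c • x) = c • nPart i π σ hσ x := by
  apply IsExtension.injective i π
  simp only [map_smul, nPart_spec, smul_sub]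

theorem map_inclusion_eq_zero (s : n) : π (i s) = 0 :=
  ((LieHom.range_eq_ker_iff i π).mp
    (LieAlgebra.IsExtension.exact (i := i) (p := π))).apply_apply_eq_zero s

theorem nPart_inclusion (s : n) : nPart i π σ hσ (i s) = s := by
  apply IsExtension.injective i π
  rw [nPart_spec, map_inclusion_eq_zero i π, map_zero, sub_zero]

variable {F : FreeResolution k n} (Θ : CompatibleAction i σ F)

/-- The action of `g = n ⊕ σ(h)` on `F_b` that combines the action of `n` with the compatible
action of `h`. -/
@[reducible] noncomputable def CompatibleAction.lieRingModule (b : ℕ) :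
    LieRingModule g (F.X b) where
  bracket x m := ⁅nPart i π σ hσ x, m⁆ + Θ.Θ b (π x) m
  add_lie x y m := by
    rw [nPart_add, add_lie, map_add, map_add, LinearMap.add_apply]
    abel
  lie_add x m m' := by
    rw [lie_add, map_add]
    abel
  leibniz_lie x y m := by
    have key : ∀ x y : g, i (nPart i π σ hσ ⁅σ (π x), i (nPart i π σ hσ y)⁆) =
        ⁅σ (π x), i (nPart i π σ hσ y)⁆ := fun x y => by
      rw [nPart_spec, LieHom.map_lie, map_inclusion_eq_zero i π, lie_zero, map_zero, sub_zero]
    have hxy : nPart i π σ hσ ⁅x, y⁆ = ⁅nPart i π σ hσ x, nPart i π σ hσ y⁆ +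
        nPart i π σ hσ ⁅σ (π x), i (nPart i π σ hσ y)⁆ -
        nPart i π σ hσ ⁅σ (π y), i (nPart i π σ hσ x)⁆ := by
      apply IsExtension.injective i π
      rw [map_sub, map_add, key, key, LieHom.map_lie]
      simp only [nPart_spec, LieHom.map_lie, lie_sub, sub_lie]
      rw [← lie_skew (σ (π y)) x, ← lie_skew (σ (π y)) (σ (π x))]
      abel
    have h1 := Θ.compat b (π x) _ _ m (key x y)
    have h2 := Θ.compat b (π y) _ _ m (key y x)
    have h3 : Θ.Θ b ⁅π x, π y⁆ m = Θ.Θ b (π x) (Θ.Θ b (π y) m) -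
        Θ.Θ b (π y) (Θ.Θ b (π x) m) := by
      rw [LieHom.map_lie]
      rfl
    change ⁅nPart i π σ hσ x, ⁅nPart i π σ hσ y, m⁆ + Θ.Θ b (π y) m⁆ +
        Θ.Θ b (π x) (⁅nPart i π σ hσ y, m⁆ + Θ.Θ b (π y) m) =
      (⁅nPart i π σ hσ ⁅x, y⁆, m⁆ + Θ.Θ b (π ⁅x, y⁆) m) +
      (⁅nPart i π σ hσ y, ⁅nPart i π σ hσ x, m⁆ + Θ.Θ b (π x) m⁆ +
        Θ.Θ b (π y) (⁅nPart i π σ hσ x, m⁆ + Θ.Θ b (π x) m))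
    rw [hxy, sub_lie, add_lie, h1, h2, LieHom.map_lie, h3, lie_lie]
    simp only [lie_add, map_add]
    abel

theorem CompatibleAction.lie_eq (b : ℕ) (x : g) (m : F.X b) :
    letI := Θ.lieRingModule i π σ hσ b
    ⁅x, m⁆ = ⁅nPart i π σ hσ x, m⁆ + Θ.Θ b (π x) m := rfl

/-- The resolution `F`, as a resolution of `k` by `g`-modules. -/
noncomputable def CompatibleAction.lieResolution : LieResolution k g :=
  letI := Θ.lieRingModule i π σ hσ
  { X := F.X
    lieModule := fun b =>
      { smul_lie := fun c x m => by
          rw [Θ.lie_eq i π σ hσ, Θ.lie_eq i π σ hσ, nPart_smul, map_smul, map_smul, smul_lie, smul_add]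
          rfl
        lie_smul := fun c x m => by
          rw [Θ.lie_eq i π σ hσ, Θ.lie_eq i π σ hσ, lie_smul, map_smul, smul_add] }
    d := fun b =>
      { (F.d b : F.X (b + 1) →ₗ[k] F.X b) with
        map_lie' := fun {x m} => by
          change F.d b (⁅nPart i π σ hσ x, m⁆ + Θ.Θ (b + 1) (π x) m) =
            ⁅nPart i π σ hσ x, F.d b m⁆ + Θ.Θ b (π x) (F.d b m)
          rw [map_add, Θ.comm_d, LieModuleHom.map_lie] }
    ε := F.ε
    ε_lie := fun x m => by
      rw [Θ.lie_eq i π σ hσ, map_add, F.ε_lie, Θ.ε_zero, add_zero]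
    ε_surjective := F.ε_surjective
    exact_zero := F.exact_zero
    exact_succ := F.exact_succ }

noncomputable instance (b : ℕ) : LieRingModule n ((Θ.lieResolution i π σ hσ).X b) :=
  F.lieRingModule b

instance (b : ℕ) : LieModule k n ((Θ.lieResolution i π σ hσ).X b) :=
  F.lieModule b

theorem CompatibleAction.inclusion_lie (b : ℕ) (s : n) (m : (Θ.lieResolution i π σ hσ).X b) :
    ⁅i s, m⁆ = ⁅s, m⁆ := by
  have key : ∀ m : F.X b, ⁅nPart i π σ hσ (i s), m⁆ + Θ.Θ b (π (i s)) m = ⁅s, m⁆ := fun m => by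
    rw [nPart_inclusion, map_inclusion_eq_zero i π, map_zero, LinearMap.zero_apply, add_zero]
  exact key m

end CompatibleAction

/-! ### Comparison with the Hochschild–Serre double complex -/

section Comparison

variable {k : Type*} [Field k]
  {n : Type*} [LieRing n] [LieAlgebra k n]
  {g : Type*} [LieRing g] [LieAlgebra k g]
  {h : Type*} [LieRing h] [LieAlgebra k h]
  (i : n →ₗ⁅k⁆ g) (π : g →ₗ⁅k⁆ h)
  (M : Type*) [AddCommGroup M] [Module k M] [LieRingModule g M] [LieModule k g M]
  (P : FreeResolution k h)

/-- The double complex `Hom_h(P_a, Hom_n(G_b, M))` of a resolution `G` by `g`-modules, with the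
sign conventions of `hsDouble`. -/
def homDouble (G : LieResolution k g) : DoubleComplex k where
  C a b := HomHN i π (P.X a) (G.X b) M
  dh a b := homHNMap i π M (P.d a) (LieModuleHom.id : G.X b →ₗ⁅k, g⁆ G.X b)
  dv a b := (-1 : k) ^ a • homHNMap i π M (LieModuleHom.id : P.X a →ₗ⁅k, h⁆ P.X a) (G.d b)
  dh_dh a b f := by
    ext y z
    have : P.d a (P.d (a + 1) y) = 0 := (P.exact_succ a).apply_apply_eq_zero y
    change (f : P.X a →ₗ[k] G.X b →ₗ[k] M) (P.d a (P.d (a + 1) y)) z = 0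
    rw [this, map_zero, LinearMap.zero_apply]
  dv_dv a b f := by
    ext y z
    have : G.d b (G.d (b + 1) z) = 0 := (G.exact_succ b).apply_apply_eq_zero z
    change (-1 : k) ^ a • (-1 : k) ^ a •
      (f : P.X a →ₗ[k] G.X b →ₗ[k] M) y (G.d b (G.d (b + 1) z)) = 0
    rw [this, map_zero, smul_zero, smul_zero]
  dh_dv a b f := by
    ext y z
    change (-1 : k) ^ a • (f : P.X a →ₗ[k] G.X b →ₗ[k] M) (P.d a y) (G.d b z)
      + (-1 : k) ^ (a + 1) • (f : P.X a →ₗ[k] G.X b →ₗ[k] M) (P.d a y) (G.d b z) = 0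
    rw [pow_succ, mul_neg_one, neg_smul, add_neg_cancel]

open FilteredComplex DoubleComplex

/-- The map from the double complex of `G` to the Hochschild–Serre double complex induced by a map
of resolutions `φ : Q → G` gives quasi-isomorphisms on the graded pieces. -/
theorem coneExact_homDouble [LieAlgebra.IsExtension i π] (σ : h →ₗ⁅k⁆ g) (hσ : ∀ α, π (σ α) = α)
    (Q : FreeResolution k g) (G : LieResolution k g)
    [∀ b, LieRingModule n (G.X b)] [∀ b, LieModule k n (G.X b)]
    (hiG : ∀ b (s : n) (x : G.X b), ⁅i s, x⁆ = ⁅s, x⁆)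
    (hG : ∀ b, IsFreeLieModule k n (G.X b))
    (φ : ∀ b, Q.X b →ₗ⁅k, g⁆ G.X b) (hφ₀ : ∀ x, G.ε (φ 0 x) = Q.ε x)
    (hφ : ∀ b x, G.d b (φ (b + 1) x) = φ b (Q.d b x)) :
    ConeExact (A := (homDouble i π M P G).total) (B := (hsDouble i π M P Q).total)
      (totalMap fun _ b => homHNMap i π M LieModuleHom.id (φ b)) 1 := by
  have c := fun a => homHN_cone_exact_smul i π σ hσ (P.X a) Q G M (P.free a) hiG hG φ hφ₀ hφ
    (c := (-1 : k) ^ a) (by rw [← mul_pow, neg_one_mul, neg_neg, one_pow])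
  exact coneExact_one (fun a => (c a).1) (fun a => (c a).2.1) (fun a => (c a).2.2)

end Comparison

open FilteredComplex DoubleComplex in
/-- The range of rows for which the hypothesis on `F` forces `d_r` to vanish. -/
theorem hochschildSerre_d_eq_zero {k : Type*} [Field k]
    {n : Type*} [LieRing n] [LieAlgebra k n]
    {g : Type*} [LieRing g] [LieAlgebra k g]
    {h : Type*} [LieRing h] [LieAlgebra k h]
    (i : n →ₗ⁅k⁆ g) (π : g →ₗ⁅k⁆ h) [LieAlgebra.IsExtension i π]
    (σ : h →ₗ⁅k⁆ g) (hσ : ∀ α, π (σ α) = α)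
    (M : Type*) [AddCommGroup M] [Module k M] [LieRingModule g M] [LieModule k g M]
    (F : FreeResolution k n) (Θ : CompatibleAction i σ F)
    (q : ℕ) (hq : ∀ b : ℕ, b + 1 = q → homDiff i F M b = 0)
    (P : FreeResolution k h) (Q : FreeResolution k g)
    (p r s : ℤ) (hs : q ≤ s) (hs' : s ≤ q + r - 2) :
    (hochschildSerre i π M P Q).d r p s = 0 := by
  let G := Θ.lieResolution i π σ hσ
  have hiG : ∀ b (s : n) (x : G.X b), ⁅i s, x⁆ = ⁅s, x⁆ := Θ.inclusion_lie i π σ hσ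
  obtain ⟨φ, hφ₀, hφ⟩ := Q.exists_chainMap G
  have hcone := coneExact_homDouble i π M P σ hσ Q G hiG F.free φ hφ₀ hφ
  have hdv : ∀ b, b + 1 = q → ∀ a, (homDouble i π M P G).dv a b = 0 := fun b hb a => by
    refine LinearMap.ext fun (f : HomHN i π (P.X a) (G.X b) M) =>
      Subtype.ext (LinearMap.ext₂ fun y z => ?_)
    have hf : (f : P.X a →ₗ[k] G.X b →ₗ[k] M) y ∈ HomN i (F.X b) M := fun s m =>
      (congrArg _ (hiG b s m)).symm.trans (f.2.1 y s m)
    have h0 : (f : P.X a →ₗ[k] G.X b →ₗ[k] M) y (F.d b z) = 0 :=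
      LinearMap.congr_fun (congrArg Subtype.val (LinearMap.congr_fun (hq b hb) ⟨_, hf⟩)) z
    change (-1 : k) ^ a • (f : P.X a →ₗ[k] G.X b →ₗ[k] M) y (F.d b z) = 0
    rw [h0, smul_zero]
  lift r to ℕ using by omega
  have hD := totalMap_D (A := homDouble i π M P G) (B := hsDouble i π M P Q)
    (φ := fun a b => homHNMap i π M LieModuleHom.id (φ b)) (fun a b x => rfl) (fun a b (x : HomHN i π (P.X a) (G.X b) M) => by
      change homHNMap i π M LieModuleHom.id (φ (b + 1))
          ((-1 : k) ^ a • homHNMap i π M LieModuleHom.id (G.d b) x) =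
        (-1 : k) ^ a • homHNMap i π M LieModuleHom.id (Q.d b)
          (homHNMap i π M LieModuleHom.id (φ b) x)
      rw [map_smul]
      congr 1
      ext y z
      exact congrArg ((x : P.X a →ₗ[k] G.X b →ₗ[k] M) y) (hφ b z))
  exact d_eq_zero_of_exists _ _ _ _
    ((ConeExact.of_one hD hcone r).exists_of_exists hD totalMap_mem_Fil (by omega)
      (exists_mem_columnFil_of_dv_eq_zero _ q hdv r p s hs hs'))

end HS

theorem mainTheorem1 {k : Type*} [Field k]
    {n : Type*} [LieRing n] [LieAlgebra k n]
    {g : Type*} [LieRing g] [LieAlgebra k g]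
    {h : Type*} [LieRing h] [LieAlgebra k h]
    (i : n →ₗ⁅k⁆ g) (π : g →ₗ⁅k⁆ h) [LieAlgebra.IsExtension i π]
    (σ : h →ₗ⁅k⁆ g) (hσ : ∀ α, π (σ α) = α)
    (M : Type*) [AddCommGroup M] [Module k M] [LieRingModule g M] [LieModule k g M]
    (F : HS.FreeResolution k n) (Θ : HS.CompatibleAction i σ F)
    (q : ℕ) (hq : ∀ b : ℕ, b + 1 = q → HS.homDiff i F M b = 0)
    (P : HS.FreeResolution k h) (Q : HS.FreeResolution k g)
    (p r : ℤ) (hr : 2 ≤ r) :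
    (HS.hochschildSerre i π M P Q).d r p q = 0 ∧
      (HS.hochschildSerre i π M P Q).d r p (q + r - 2) = 0 :=
  ⟨HS.hochschildSerre_d_eq_zero i π σ hσ M F Θ q hq P Q p r q le_rfl (by omega),
    HS.hochschildSerre_d_eq_zero i π σ hσ M F Θ q hq P Q p r _ (by omega) le_rfl⟩
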